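/- For a viscosity $\nu>1$, put $h=10\log\nu$ (natural logarithm). Let $U:[0,h]\to\mathbb{R}$ be a $C^\infty$ profile such that $U=U_y=0$ on $[0,\delta_1)$ for some $\delta_1\in(0,h)$. For a wave number $k\in\{1,2,3,\dots\}$ call $\lambda\in\mathbb{C}$ an eigenvalue for $k$ if there are $C^2$ functions $\omega,\psi,w:[0,h]\to\mathbb{C}$, with $(\omega,w)$ not identically zero, such that on $[0,h]$ $$\omega''-\Big(k^2+\frac{\lambda}{\nu}\Big)\omega=0,\qquad \omega(h)=0,\quad \omega(0)=ik\,w(0),$$ $$\psi''-k^2\psi=-\omega,\qquad \psi(0)=\psi(h)=0,$$ $$w''-(k^2+\lambda)w=ik\,U_y\,\psi,\qquad w'(0)=w'(h)=0.$$ (This is the spectral problem, for the Fourier modes $e^{ikx}$, of the linearization at the temperature profile $U$ of the two-dimensional Navier–Stokes/heat system with the Marangoni condition at $y=0$; $\omega,\psi,w$ are the amplitudes of vorticity, stream function and temperature perturbation.) **Proposition.** For every integer $N\ge 1$ there are $\delta_N>0$ and $\nu_0(N)>0$ and, for every $\nu>\nu_0(N)$, a $C^\infty$ profile $U=U_N(\cdot,\nu)$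 on $[0,h]$ vanishing near $y=0$ as above, such that for every $\nu>\nu_0(N)$: (i) for every $k\in\{1,\dots,N\}$, $\lambda=0$ is an eigenvalue for $k$, and every other eigenvalue for $k$ satisfies $\operatorname{Re}\lambda<-\delta_N$; (ii) for every $k>N$, all eigenvalues $\lambda$ for $k$ satisfy $\operatorname{Re}\lambda<-\delta_N$. In particular $\delta_N$ does not depend on $\nu$ or $k$. -/

import Mathlib

open Set
open scoped ContDiff

namespace Marangoni

/-- A vertical temperature profile on `[0, h]`: a `C^∞` real function on `[0, h]` such that
`U = U_y = 0` on `[0, δ₁)` for some `δ₁ ∈ (0, h)`. -/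
structure IsProfile (h : ℝ) (U : ℝ → ℝ) : Prop where
  smooth : ContDiffOn ℝ ∞ U (Icc 0 h)
  flat : ∃ δ₁ ∈ Ioo 0 h, ∀ y ∈ Ico 0 δ₁, U y = 0 ∧ derivWithin U (Icc 0 h) y = 0

/-- `(om, psi, w)` solves the boundary value problem on `[0, h]` satisfied by the amplitudes of the
vorticity, the stream function and the temperature perturbation in the Fourier mode `exp (i k x)`,
with spectral parameter `lam`, viscosity `ν` and profile `U`. Primes are one-sided at the ends of
the interval. -/
structure IsMode (ν h : ℝ) (U : ℝ → ℝ) (k : ℕ) (lam : ℂ) (om psi w : ℝ → ℂ) : Prop where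
  smooth_om : ContDiffOn ℝ 2 om (Icc 0 h)
  smooth_psi : ContDiffOn ℝ 2 psi (Icc 0 h)
  smooth_w : ContDiffOn ℝ 2 w (Icc 0 h)
  /-- `om'' - (k² + lam / ν) om = 0` -/
  eq_om : ∀ y ∈ Icc 0 h,
    iteratedDerivWithin 2 om (Icc 0 h) y - ((k : ℂ) ^ 2 + lam / (ν : ℂ)) * om y = 0
  /-- `psi'' - k² psi = - om` -/
  eq_psi : ∀ y ∈ Icc 0 h,
    iteratedDerivWithin 2 psi (Icc 0 h) y - (k : ℂ) ^ 2 * psi y = - om y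
  /-- `w'' - (k² + lam) w = i k U_y psi` -/
  eq_w : ∀ y ∈ Icc 0 h,
    iteratedDerivWithin 2 w (Icc 0 h) y - ((k : ℂ) ^ 2 + lam) * w y =
      Complex.I * (k : ℂ) * ((derivWithin U (Icc 0 h) y : ℝ) : ℂ) * psi y
  om_top : om h = 0
  /-- the Marangoni condition -/
  om_bot : om 0 = Complex.I * (k : ℂ) * w 0
  psi_top : psi h = 0
  psi_bot : psi 0 = 0
  w_top : derivWithin w (Icc 0 h) h = 0
  w_bot : derivWithin w (Icc 0 h) 0 = 0

/-- `lam` is an eigenvalue of the boundary value problem for the wave number `k`: there is a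
solution whose (vorticity, temperature) pair does not vanish identically on `[0, h]`. -/
def IsEigenvalue (ν h : ℝ) (U : ℝ → ℝ) (k : ℕ) (lam : ℂ) : Prop :=
  ∃ om psi w : ℝ → ℂ, IsMode ν h U k lam om psi w ∧ ∃ y ∈ Icc 0 h, om y ≠ 0 ∨ w y ≠ 0

end Marangoni

/-! Put E = k² + λ/ν and s² = k² + λ. Solving for the vorticity and then the stream function leaves
both as multiples of w(0). Pairing the temperature equation with `tKer` then reduces the eigenvalue
problem to the scalar equation `charFun` = s/k, where `charFun` is the integral of U_y against
`charKer` (`charFun_eq_of_isEigenvalue`). At λ = 0 the equation reads `charFun` = 1, and this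
already suffices for 0 to be an eigenvalue (`isEigenvalue_zero_of_charFun`).

As h grows, `charKer` at λ = 0 tends to (y/2) exp(-2ky) on compact sets. If (y/2) U_y were a unit
mass at y = 0, every k would have the eigenvalue 0. The profile smears this mass over a bump in
[ε/2, ε], which leaves a defect O(Nε) for k ≤ N. N further bumps, centred near B, 2B, ..., NB,
repair the defect exactly. Their coefficients solve a linear system that becomes diagonally dominant
after a Gaussian rescaling, so they are O(ε) with explicit growth (`exists_coeff`).

For k > N the smearing pushes `charFun` below 1 - ε/2 and the repairs are too small to undo this
(`norm_charFun_lt_one`), whereas an eigenvalue with Re λ ≥ -δ would need |s/k| close to 1 or larger.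
For k ≤ N, `charFun` varies with λ by at most |s - k|/(2N) (`norm_charFun_sub_le`): the main bump
sits near 0, where the kernel hardly depends on s, the far bumps have small coefficients, and E - k²
= λ/ν is small. Since s/k - 1 = (s - k)/k, this forces s = k. All parameters are fixed before h,
hence δ does not depend on ν. -/

namespace Marangoni

/-! ### Complex hyperbolic functions and the square root -/

lemma sinh_re_le_norm_sinh (z : ℂ) : Real.sinh z.re ≤ ‖Complex.sinh z‖ := by
  have h1 : ‖Complex.exp z‖ - ‖Complex.exp (-z)‖ ≤ ‖Complex.exp z - Complex.exp (-z)‖ :=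
    norm_sub_norm_le _ _
  rw [Complex.norm_exp, Complex.norm_exp, Complex.neg_re] at h1
  rw [Complex.sinh, Real.sinh_eq, norm_div, Complex.norm_ofNat]
  linarith

lemma norm_cosh_le (z : ℂ) : ‖Complex.cosh z‖ ≤ Real.cosh z.re := by
  have h1 := norm_add_le (Complex.exp z) (Complex.exp (-z))
  rw [Complex.norm_exp, Complex.norm_exp, Complex.neg_re] at h1
  rw [Complex.cosh, Real.cosh_eq, norm_div, Complex.norm_ofNat]
  linarith

lemma norm_sinh_le (z : ℂ) : ‖Complex.sinh z‖ ≤ Real.cosh z.re := by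
  have h1 := norm_sub_le (Complex.exp z) (Complex.exp (-z))
  rw [Complex.norm_exp, Complex.norm_exp, Complex.neg_re] at h1
  rw [Complex.sinh, Real.cosh_eq, norm_div, Complex.norm_ofNat]
  linarith

lemma sinh_ne_zero_of_re_pos {z : ℂ} (hz : 0 < z.re) : Complex.sinh z ≠ 0 := by
  have h1 := sinh_re_le_norm_sinh z
  have h2 := Real.sinh_pos_iff.2 hz
  exact norm_pos_iff.1 (h2.trans_le h1)

lemma sinh_mul_ofReal_ne_zero {m : ℂ} {h : ℝ} (hm : 0 < m.re) (hh : 0 < h) :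
    Complex.sinh (m * h) ≠ 0 :=
  sinh_ne_zero_of_re_pos (by rw [Complex.re_mul_ofReal]; positivity)

/-- The principal square root. -/
noncomputable def csqrt (E : ℂ) : ℂ := E ^ (1 / 2 : ℂ)

lemma csqrt_sq (E : ℂ) : csqrt E ^ 2 = E := by
  simp [csqrt]

lemma csqrt_re_nonneg (E : ℂ) : 0 ≤ (csqrt E).re := by
  by_cases hE : E = 0
  · simp [csqrt, hE]
  · rw [csqrt, Complex.cpow_def_of_ne_zero hE, Complex.exp_re]
    refine mul_nonneg (Real.exp_pos _).le (Real.cos_nonneg_of_mem_Icc ?_)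
    have h1 : (Complex.log E * (1 / 2 : ℂ)).im = E.arg / 2 := by
      rw [show (1 / 2 : ℂ) = ((1 / 2 : ℝ) : ℂ) by push_cast; ring, Complex.im_mul_ofReal,
        Complex.log_im]
      ring
    rw [h1]
    constructor <;> linarith [Complex.neg_pi_lt_arg E, Complex.arg_le_pi E]

/-- The real part of a square is at most the square of the real part. This turns a half-plane
condition on the spectral parameter into a decay rate. -/
lemma le_csqrt_re {E : ℂ} {c : ℝ} (h : c ^ 2 ≤ E.re) : c ≤ (csqrt E).re := by
  have h1 : E.re = (csqrt E).re ^ 2 - (csqrt E).im ^ 2 := by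
    conv_lhs => rw [← csqrt_sq E]
    rw [pow_two, Complex.mul_re]; ring
  refine le_of_abs_le (abs_le_of_sq_le_sq ?_ (csqrt_re_nonneg E))
  nlinarith [sq_nonneg (csqrt E).im]

lemma csqrt_sq_ofReal {k : ℝ} (hk : 0 ≤ k) : csqrt ((k : ℂ) ^ 2) = k := by
  rw [csqrt, show (1 / 2 : ℂ) = ((1 / 2 : ℝ) : ℂ) by push_cast; ring, ← Complex.ofReal_pow,
    ← Complex.ofReal_cpow (by positivity), ← Real.sqrt_eq_rpow, Real.sqrt_sq hk]

lemma hasDerivAt_csqrt {E : ℂ} (hE : 0 < E.re) : HasDerivAt csqrt (1 / (2 * csqrt E)) E := by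
  have h0 : E ≠ 0 := by rintro rfl; simp at hE
  have h1 := (hasDerivAt_id E).cpow_const (c := (1 / 2 : ℂ)) (Or.inl hE)
  have hs : csqrt E ≠ 0 := by
    intro h; have := csqrt_sq E; rw [h] at this; simp at this; exact h0 this.symm
  refine h1.congr_deriv ?_
  have h2 : (id E) ^ ((1 / 2 : ℂ) - 1) = csqrt E / E := by
    simp only [id]
    rw [Complex.cpow_sub _ _ h0, Complex.cpow_one]; rfl
  rw [h2]
  nth_rewrite 2 [← csqrt_sq E]
  field_simp

/-! ### Kernels as functions of the spectral parameter -/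

/-- The solution of `u'' = m² u` with `u 0 = 1`, `u h = 0`. -/
noncomputable def sKer (h y : ℝ) (m : ℂ) : ℂ := Complex.sinh (m * (h - y)) / Complex.sinh (m * h)

/-- A solution of `u'' = m² u` with `u' h = 0`. -/
noncomputable def tKer (h y : ℝ) (m : ℂ) : ℂ := Complex.cosh (m * (h - y)) / Complex.sinh (m * h)

/-- Minus the derivative of `sKer h y m` with respect to `m²`. -/
noncomputable def gKer (h y : ℝ) (m : ℂ) : ℂ :=
  (y * tKer h y m - h * (Complex.sinh (m * y) / Complex.sinh (m * h) ^ 2)) / (2 * m)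

/-- The solution of `u'' - k² u = - sKer h y (csqrt E)`, `u 0 = u h = 0`. -/
noncomputable def streamKer (h y k : ℝ) (E : ℂ) : ℂ :=
  - dslope (fun E => sKer h y (csqrt E)) ((k : ℂ) ^ 2) E

lemma hasDerivAt_sKer {h y : ℝ} {m : ℂ} (hh : 0 < h) (hm : 0 < m.re) :
    HasDerivAt (sKer h y) (-(2 * m) * gKer h y m) m := by
  have hs := sinh_mul_ofReal_ne_zero hm hh
  have hm0 : m ≠ 0 := by rintro rfl; simp at hm
  have h1 : HasDerivAt (fun m : ℂ => m * ((h : ℂ) - y)) ((h : ℂ) - y) m := by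
    simpa using (hasDerivAt_id m).mul_const ((h : ℂ) - y)
  have h2 : HasDerivAt (fun m : ℂ => m * (h : ℂ)) (h : ℂ) m := by
    simpa using (hasDerivAt_id m).mul_const (h : ℂ)
  refine (h1.csinh.div h2.csinh hs).congr_deriv ?_
  unfold gKer tKer
  -- Writing y = h - (h - y) leaves only functions of mh and m(h - y).
  have e : Complex.sinh (m * y) = Complex.sinh (m * h) * Complex.cosh (m * (h - y))
      - Complex.cosh (m * h) * Complex.sinh (m * (h - y)) := by
    rw [← Complex.sinh_sub]; ring_nf
  rw [e]
  field_simp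
  ring

lemma hasDerivAt_tKer {h y : ℝ} {m : ℂ} (hh : 0 < h) (hm : 0 < m.re) :
    HasDerivAt (tKer h y) (-(h * (Complex.cosh (m * y) / Complex.sinh (m * h) ^ 2)
      + y * sKer h y m)) m := by
  have hs := sinh_mul_ofReal_ne_zero hm hh
  have h1 : HasDerivAt (fun m : ℂ => m * ((h : ℂ) - y)) ((h : ℂ) - y) m := by
    simpa using (hasDerivAt_id m).mul_const ((h : ℂ) - y)
  have h2 : HasDerivAt (fun m : ℂ => m * (h : ℂ)) (h : ℂ) m := by
    simpa using (hasDerivAt_id m).mul_const (h : ℂ)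
  refine (h1.ccosh.div h2.csinh hs).congr_deriv ?_
  unfold sKer
  have e : Complex.cosh (m * y) = Complex.cosh (m * h) * Complex.cosh (m * (h - y))
      - Complex.sinh (m * h) * Complex.sinh (m * (h - y)) := by
    rw [← Complex.cosh_sub]; ring_nf
  rw [e]
  field_simp
  ring

lemma hasDerivAt_sKer_csqrt {h y : ℝ} {E : ℂ} (hh : 0 < h) (hE : 0 < E.re) :
    HasDerivAt (fun E => sKer h y (csqrt E)) (-gKer h y (csqrt E)) E := by
  have hm : 0 < (csqrt E).re := by
    have := le_csqrt_re (E := E) (c := √E.re) (by rw [Real.sq_sqrt hE.le])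
    exact (Real.sqrt_pos.2 hE).trans_le this
  have hm0 : csqrt E ≠ 0 := by intro h0; rw [h0] at hm; simp at hm
  refine ((hasDerivAt_sKer (y := y) hh hm).comp E (hasDerivAt_csqrt hE)).congr_deriv ?_
  field_simp

lemma streamKer_self {h y k : ℝ} (hh : 0 < h) (hk : 0 < k) :
    streamKer h y k ((k : ℂ) ^ 2) = gKer h y k := by
  have h1 : 0 < ((k : ℂ) ^ 2).re := by rw [← Complex.ofReal_pow, Complex.ofReal_re]; positivity
  rw [streamKer, dslope_same, (hasDerivAt_sKer_csqrt hh h1).deriv, csqrt_sq_ofReal hk.le, neg_neg]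

lemma streamKer_of_ne {h y k : ℝ} {E : ℂ} (hk : 0 < k) (hE : E ≠ (k : ℂ) ^ 2) :
    streamKer h y k E = (sKer h y k - sKer h y (csqrt E)) / (E - (k : ℂ) ^ 2) := by
  rw [streamKer, dslope_of_ne _ hE, slope_def_field, csqrt_sq_ofReal hk.le, ← neg_div, neg_sub]

/-! ### Comparison with the half-line kernels -/

/-- `h` is so large, depending on `a`, `Y`, `η`, that on `[a, Y]` the kernels are within relative
error `O(η)` of those of the half line. -/
structure IsTall (a Y η h : ℝ) : Prop where
  a_pos : 0 < a
  a_le : a ≤ Y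
  η_pos : 0 < η
  η_le : η ≤ 1
  lt : Y < h
  two_le : 2 ≤ h
  tail : 16 * h * Real.exp (Y - h) ≤ η * a
  small : 3 * Real.exp (Y - h) ≤ η

lemma eventually_isTall {a Y η : ℝ} (ha : 0 < a) (haY : a ≤ Y) (h0 : 0 < η) (h1 : η ≤ 1) :
    ∀ᶠ h in Filter.atTop, IsTall a Y η h := by
  have e1 : Filter.Tendsto (fun h : ℝ => 16 * h * Real.exp (Y - h)) Filter.atTop (nhds 0) := by
    have := (Real.tendsto_pow_mul_exp_neg_atTop_nhds_zero 1).const_mul (16 * Real.exp Y)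
    rw [mul_zero] at this
    refine this.congr fun h => ?_
    rw [sub_eq_add_neg, Real.exp_add]; ring
  have e2 : Filter.Tendsto (fun h : ℝ => 3 * Real.exp (Y - h)) Filter.atTop (nhds 0) := by
    have := (Real.tendsto_pow_mul_exp_neg_atTop_nhds_zero 0).const_mul (3 * Real.exp Y)
    rw [mul_zero] at this
    refine this.congr fun h => ?_
    rw [sub_eq_add_neg, Real.exp_add]; ring
  filter_upwards [e1.eventually_le_const (show (0:ℝ) < η * a by positivity),
    e2.eventually_le_const h0, Filter.eventually_gt_atTop Y, Filter.eventually_ge_atTop 2]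
    with h t1 t2 t3 t4
  exact ⟨ha, haY, h0, h1, t3, t4, t1, t2⟩

section bounds
variable {a Y η h y : ℝ} {m : ℂ}

lemma IsTall.pos (H : IsTall a Y η h) : 0 < h := by linarith [H.two_le]

lemma IsTall.cosh_div_sinh_le (H : IsTall a Y η h) (hy : y ∈ Icc a Y) {x : ℝ} (hx : 1 / 2 ≤ x) :
    Real.cosh (x * (h - y)) / Real.sinh (x * h) ≤ (1 + η) * Real.exp (-(x * y)) := by
  have hp := H.pos
  have hs : 0 < Real.sinh (x * h) := Real.sinh_pos_iff.2 (by nlinarith)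
  rw [div_le_iff₀ hs, Real.cosh_eq, Real.sinh_eq]
  have ha := H.a_pos
  -- An error η/3 in numerator and denominator is affordable: 1 + η/3 ≤ (1 + η)(1 - η/3) when 0 ≤ η
  -- ≤ 1.
  have h1 : Real.exp (-(x * (h - y))) ≤ η / 3 * Real.exp (x * (h - y)) := by
    have : Real.exp (-(x * (h - y))) = Real.exp (-(2 * x * (h - y))) * Real.exp (x * (h - y)) := by
      rw [← Real.exp_add]; ring_nf
    rw [this]
    refine mul_le_mul_of_nonneg_right ?_ (Real.exp_pos _).le
    have : Real.exp (-(2 * x * (h - y))) ≤ Real.exp (Y - h) :=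
      Real.exp_le_exp.2 (by nlinarith [hy.2, H.lt])
    linarith [H.small]
  have h2 : Real.exp (-(x * y)) * Real.exp (x * h) = Real.exp (x * (h - y)) := by
    rw [← Real.exp_add]; ring_nf
  have h3 : Real.exp (-(x * y)) * Real.exp (-(x * h)) ≤ Real.exp (-(x * (h - y))) := by
    rw [← Real.exp_add]; exact Real.exp_le_exp.2 (by nlinarith [hy.1])
  have h4 := mul_le_mul_of_nonneg_left h3 (show 0 ≤ 1 + η by linarith [H.η_pos])
  nlinarith [H.η_le, Real.exp_pos (-(x * (h - y)))]

lemma IsTall.norm_tKer_le (H : IsTall a Y η h) (hy : y ∈ Icc a Y) (hm : 1 / 2 ≤ m.re) :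
    ‖tKer h y m‖ ≤ (1 + η) * Real.exp (-(m.re * y)) := by
  refine le_trans ?_ (H.cosh_div_sinh_le hy hm)
  have hp := H.pos
  have hs : 0 < Real.sinh (m.re * h) := Real.sinh_pos_iff.2 (by nlinarith)
  have e1 := norm_cosh_le (m * (h - y))
  have e2 := sinh_re_le_norm_sinh (m * h)
  rw [← Complex.ofReal_sub, Complex.re_mul_ofReal] at e1
  rw [Complex.re_mul_ofReal] at e2
  rw [tKer, norm_div, ← Complex.ofReal_sub]
  exact div_le_div₀ (Real.cosh_pos _).le e1 hs e2

lemma IsTall.norm_sKer_le (H : IsTall a Y η h) (hy : y ∈ Icc a Y) (hm : 1 / 2 ≤ m.re) :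
    ‖sKer h y m‖ ≤ (1 + η) * Real.exp (-(m.re * y)) := by
  refine le_trans ?_ (H.cosh_div_sinh_le hy hm)
  have hp := H.pos
  have hs : 0 < Real.sinh (m.re * h) := Real.sinh_pos_iff.2 (by nlinarith)
  have e1 := norm_sinh_le (m * (h - y))
  have e2 := sinh_re_le_norm_sinh (m * h)
  rw [← Complex.ofReal_sub, Complex.re_mul_ofReal] at e1
  rw [Complex.re_mul_ofReal] at e2
  rw [sKer, norm_div, ← Complex.ofReal_sub]
  exact div_le_div₀ (Real.cosh_pos _).le e1 hs e2

/-- The finite-depth correction carries a factor h but decays like exp(-2x(h - y)) relative to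
exp(-xy). The factor y on the right, needed for averages against y/2, comes from y ≥ a. -/
lemma IsTall.tail_le (H : IsTall a Y η h) (hy : y ∈ Icc a Y) {x : ℝ} (hx : 1 / 2 ≤ x) :
    h * (Real.cosh (x * y) / Real.sinh (x * h) ^ 2) ≤ η * y * Real.exp (-(x * y)) := by
  have hp := H.pos
  have ha := H.a_pos
  have h0 := H.η_pos
  have hxy : 0 ≤ x * y := mul_nonneg (by linarith) (by linarith [hy.1])
  have h1 : Real.exp (x * h) / 4 ≤ Real.sinh (x * h) := by
    rw [Real.sinh_eq]
    have : Real.exp (-(x * h)) ≤ 1 / 2 * Real.exp (x * h) := by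
      have e1 : Real.exp (-(x * h)) ≤ 1 := Real.exp_le_one_iff.2 (by nlinarith)
      have e2 := Real.add_one_le_exp (x * h)
      nlinarith [H.two_le]
    linarith
  have h2 : Real.cosh (x * y) ≤ Real.exp (x * y) := by
    rw [Real.cosh_eq]
    have : Real.exp (-(x * y)) ≤ Real.exp (x * y) := Real.exp_le_exp.2 (by linarith)
    linarith
  have h3 : Real.cosh (x * y) / Real.sinh (x * h) ^ 2
      ≤ Real.exp (x * y) / (Real.exp (x * h) / 4) ^ 2 := by
    refine div_le_div₀ (Real.exp_pos _).le h2 (by positivity) ?_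
    exact pow_le_pow_left₀ (by positivity) h1 2
  have h4 : Real.exp (x * y) / (Real.exp (x * h) / 4) ^ 2
      = 16 * Real.exp (-(2 * x * (h - y))) * Real.exp (-(x * y)) := by
    rw [div_pow, ← Real.exp_nat_mul, div_div_eq_mul_div, div_eq_iff (Real.exp_pos _).ne']
    rw [mul_assoc, mul_assoc, ← Real.exp_add, ← Real.exp_add]
    push_cast
    ring_nf
  have h5 : Real.exp (-(2 * x * (h - y))) ≤ Real.exp (Y - h) :=
    Real.exp_le_exp.2 (by nlinarith [hy.2, H.lt])
  calc h * (Real.cosh (x * y) / Real.sinh (x * h) ^ 2)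
      ≤ h * (16 * Real.exp (-(2 * x * (h - y))) * Real.exp (-(x * y))) := by
        rw [← h4]; exact mul_le_mul_of_nonneg_left h3 hp.le
    _ = 16 * h * Real.exp (-(2 * x * (h - y))) * Real.exp (-(x * y)) := by ring
    _ ≤ η * y * Real.exp (-(x * y)) := by
        refine mul_le_mul_of_nonneg_right ?_ (Real.exp_pos _).le
        calc _ ≤ 16 * h * Real.exp (Y - h) := by gcongr
          _ ≤ η * a := H.tail
          _ ≤ η * y := by gcongr; exact hy.1

lemma IsTall.norm_tail_le (H : IsTall a Y η h) (hy : y ∈ Icc a Y) (hm : 1 / 2 ≤ m.re) {z : ℂ}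
    (hz : ‖z‖ ≤ Real.cosh (m.re * y)) :
    ‖h * (z / Complex.sinh (m * h) ^ 2)‖ ≤ η * y * Real.exp (-(m.re * y)) := by
  have hp := H.pos
  refine le_trans ?_ (H.tail_le hy hm)
  have hs : 0 < Real.sinh (m.re * h) := Real.sinh_pos_iff.2 (by nlinarith)
  have e2 := sinh_re_le_norm_sinh (m * h)
  rw [Complex.re_mul_ofReal] at e2
  rw [norm_mul, norm_div, norm_pow, Complex.norm_of_nonneg hp.le]
  gcongr

lemma IsTall.norm_gKer_le (H : IsTall a Y η h) (hy : y ∈ Icc a Y) {c : ℝ} (hc : 1 / 2 ≤ c)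
    (hm : c ≤ m.re) :
    ‖gKer h y m‖ ≤ (1 + 2 * η) * (y / 2) * Real.exp (-(c * y)) / c := by
  have ha := H.a_pos
  have h0 := H.η_pos
  have hy0 : 0 < y := by linarith [hy.1]
  have e1 := H.norm_tKer_le hy (hc.trans hm)
  have e2 := H.norm_tail_le hy (hc.trans hm) (z := Complex.sinh (m * y))
    (by simpa using norm_sinh_le (m * y))
  have e3 : m.re ≤ ‖m‖ := Complex.re_le_norm m
  have e4 : Real.exp (-(m.re * y)) ≤ Real.exp (-(c * y)) := Real.exp_le_exp.2 (by nlinarith)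
  rw [gKer, norm_div, norm_mul, Complex.norm_ofNat]
  have e5 : ‖(y : ℂ) * tKer h y m - h * (Complex.sinh (m * y) / Complex.sinh (m * h) ^ 2)‖
      ≤ (1 + 2 * η) * y * Real.exp (-(c * y)) := by
    refine (norm_sub_le _ _).trans ?_
    rw [norm_mul, Complex.norm_of_nonneg hy0.le]
    have := mul_le_mul_of_nonneg_left e1 hy0.le
    have := mul_le_mul_of_nonneg_left e4 (show 0 ≤ (1 + 2 * η) * y by positivity)
    nlinarith
  calc _ ≤ ((1 + 2 * η) * y * Real.exp (-(c * y))) / (2 * c) := by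
        refine div_le_div₀ (by positivity) e5 (by linarith) (by linarith)
    _ = _ := by ring

/-- Mean value inequality on a half-plane, where the derivative in m is O(y). The factor y is what
makes a bump near y = 0 insensitive to s. -/
lemma IsTall.norm_tKer_sub_le (H : IsTall a Y η h) (hy : y ∈ Icc a Y) {s s' : ℂ}
    (hs : 1 / 2 ≤ s.re) (hs' : 1 / 2 ≤ s'.re) :
    ‖tKer h y s' - tKer h y s‖ ≤ 3 * y * ‖s' - s‖ := by
  have ha := H.a_pos
  have h0 := H.η_pos
  have hy0 : 0 < y := by linarith [hy.1]
  have hc : Convex ℝ {z : ℂ | 1 / 2 ≤ z.re} := convex_halfSpace_re_ge _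
  refine hc.norm_image_sub_le_of_norm_hasDerivWithin_le (f := tKer h y)
    (fun z hz => (hasDerivAt_tKer H.pos (lt_of_lt_of_le (by norm_num) hz)).hasDerivWithinAt)
    (fun z hz => ?_) hs hs'
  have hz' : 1 / 2 ≤ z.re := hz
  have e1 := H.norm_sKer_le hy hz
  have e2 := H.norm_tail_le hy hz (z := Complex.cosh (z * y))
    (by simpa using norm_cosh_le (z * y))
  have e4 : Real.exp (-(z.re * y)) ≤ 1 := Real.exp_le_one_iff.2 (by nlinarith)
  rw [norm_neg]
  refine (norm_add_le _ _).trans ?_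
  rw [norm_mul (y : ℂ), Complex.norm_of_nonneg hy0.le]
  have := mul_le_mul_of_nonneg_left e1 hy0.le
  have := mul_le_mul_of_nonneg_left e4 (show 0 ≤ (1 + 2 * η) * y by positivity)
  nlinarith [H.η_le]

/-- A difference quotient is bounded by the supremum of the derivative, here `gKer`, over the convex
half-plane containing both E and k². -/
lemma IsTall.norm_streamKer_le (H : IsTall a Y η h) (hy : y ∈ Icc a Y) {c k : ℝ} {E : ℂ}
    (hc : 1 / 2 ≤ c) (hck : c ≤ k) (hE : c ^ 2 ≤ E.re) :
    ‖streamKer h y k E‖ ≤ (1 + 2 * η) * (y / 2) * Real.exp (-(c * y)) / c := by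
  have hk2 : c ^ 2 ≤ ((k : ℂ) ^ 2).re := by
    rw [← Complex.ofReal_pow, Complex.ofReal_re]; gcongr
  by_cases hEk : E = (k : ℂ) ^ 2
  · rw [hEk, streamKer_self H.pos (by linarith)]
    exact H.norm_gKer_le hy hc (by simpa using hck)
  · have hcv : Convex ℝ {z : ℂ | c ^ 2 ≤ z.re} := convex_halfSpace_re_ge _
    have hc2 : 0 < c ^ 2 := by positivity
    have key := hcv.norm_image_sub_le_of_norm_hasDerivWithin_le
      (f := fun E => sKer h y (csqrt E)) (C := (1 + 2 * η) * (y / 2) * Real.exp (-(c * y)) / c)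
      (fun z hz => (hasDerivAt_sKer_csqrt H.pos (lt_of_lt_of_le hc2 hz)).hasDerivWithinAt)
      (fun z hz => ?_) hk2 hE
    · rw [streamKer, norm_neg, dslope_of_ne _ hEk, slope_def_field, norm_div, div_le_iff₀]
      · exact key
      · exact norm_pos_iff.2 (sub_ne_zero.2 hEk)
    · rw [norm_neg]
      exact H.norm_gKer_le hy hc (le_csqrt_re hz)

/-- Schwarz lemma on the disc of radius 1/2 about k², which the kernel maps into a ball of radius
6y; no second derivative in E has to be computed. -/
lemma IsTall.norm_streamKer_sub_le (H : IsTall a Y η h) (hy : y ∈ Icc a Y) {k : ℝ} {E : ℂ}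
    (hk : 1 ≤ k) (hE : ‖E - (k : ℂ) ^ 2‖ < 1 / 2) :
    ‖streamKer h y k E - streamKer h y k ((k : ℂ) ^ 2)‖ ≤ 12 * y * ‖E - (k : ℂ) ^ 2‖ := by
  have ha := H.a_pos
  have h0 := H.η_pos
  have hy0 : 0 < y := by linarith [hy.1]
  have hre : ∀ z ∈ Metric.ball ((k : ℂ) ^ 2) (1 / 2), 1 / 2 < z.re := by
    intro z hz
    have e1 := Complex.abs_re_le_norm (z - (k : ℂ) ^ 2)
    have e2 : ‖z - (k : ℂ) ^ 2‖ < 1 / 2 := by rwa [mem_ball_iff_norm] at hz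
    rw [Complex.sub_re, ← Complex.ofReal_pow, Complex.ofReal_re] at e1
    have e3 := (abs_le.1 (e1.trans (by simpa using e2.le))).1
    have e4 := (abs_lt.1 (e1.trans_lt (by simpa using e2))).1
    nlinarith
  have hd : DifferentiableOn ℂ (streamKer h y k) (Metric.ball ((k : ℂ) ^ 2) (1 / 2)) := by
    have : DifferentiableOn ℂ (fun E => sKer h y (csqrt E)) (Metric.ball ((k : ℂ) ^ 2) (1 / 2)) :=
      fun z hz => (hasDerivAt_sKer_csqrt H.pos (by linarith [hre z hz])
        ).differentiableAt.differentiableWithinAt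
    exact ((Complex.differentiableOn_dslope
      (Metric.ball_mem_nhds _ (by norm_num))).2 this).neg
  have hb : ∀ z ∈ Metric.ball ((k : ℂ) ^ 2) (1 / 2), ‖streamKer h y k z‖ ≤ 3 * y := by
    intro z hz
    have := H.norm_streamKer_le hy (c := 1 / 2) (k := k) (E := z) le_rfl (by linarith)
      (by linarith [hre z hz])
    have e4 : Real.exp (-(1 / 2 * y)) ≤ 1 := Real.exp_le_one_iff.2 (by linarith)
    have := mul_le_mul_of_nonneg_left e4 (show 0 ≤ (1 + 2 * η) * (y / 2) by positivity)
    have := mul_le_mul_of_nonneg_right H.η_le hy0.le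
    refine le_trans ‹_› ?_
    rw [div_le_iff₀ (by norm_num)]
    nlinarith
  have hm : MapsTo (streamKer h y k) (Metric.ball ((k : ℂ) ^ 2) (1 / 2))
      (Metric.closedBall (streamKer h y k ((k : ℂ) ^ 2)) (6 * y)) := by
    intro z hz
    rw [mem_closedBall_iff_norm]
    refine (norm_sub_le _ _).trans ?_
    linarith [hb z hz, hb _ (Metric.mem_ball_self (by norm_num))]
  have := Complex.dist_le_div_mul_dist_of_mapsTo_ball hd hm (mem_ball_iff_norm.2 hE)
  rw [dist_eq_norm, dist_eq_norm] at this
  refine this.trans_eq ?_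
  ring

/-- The kernel of the characteristic equation. -/
noncomputable def charKer (h y k : ℝ) (E s : ℂ) : ℂ := k * streamKer h y k E * tKer h y s

lemma IsTall.norm_charKer_sub_le (H : IsTall a Y η h) (hy : y ∈ Icc a Y) {k : ℝ} {E s : ℂ}
    (hk : 1 ≤ k) (hE : ‖E - (k : ℂ) ^ 2‖ < 1 / 2) (hs : 1 / 2 ≤ s.re) :
    ‖charKer h y k E s - charKer h y k ((k : ℂ) ^ 2) k‖
      ≤ (y / 2) * (18 * y * ‖s - k‖ + 48 * k * ‖E - (k : ℂ) ^ 2‖) := by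
  have ha := H.a_pos
  have h0 := H.η_pos
  have hy0 : 0 < y := by linarith [hy.1]
  have hkr : 1 / 2 ≤ (k : ℂ).re := by rw [Complex.ofReal_re]; linarith
  -- The rate k - 1/2, rather than 1/2, keeps k times the stream kernel bounded uniformly in k.
  have hEr : (k - 1 / 2) ^ 2 ≤ E.re := by
    have e1 := (Complex.abs_re_le_norm (E - (k : ℂ) ^ 2)).trans hE.le
    rw [Complex.sub_re, ← Complex.ofReal_pow, Complex.ofReal_re] at e1
    nlinarith [(abs_le.1 e1).1]
  have e1 := H.norm_streamKer_le hy (c := k - 1 / 2) (k := k) (by linarith) (by linarith) hEr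
  have e2 := H.norm_streamKer_sub_le hy hk hE
  have e3 := H.norm_tKer_sub_le hy hkr hs
  have e4 := H.norm_tKer_le hy hkr
  have e5 : ‖tKer h y k‖ ≤ 2 := by
    have : Real.exp (-((k : ℂ).re * y)) ≤ 1 := Real.exp_le_one_iff.2 (by nlinarith)
    have := mul_le_mul_of_nonneg_left this (show 0 ≤ 1 + η by linarith)
    linarith [H.η_le]
  have e6 : k * ‖streamKer h y k E‖ ≤ 3 * y := by
    have h1 : Real.exp (-((k - 1 / 2) * y)) ≤ 1 := Real.exp_le_one_iff.2 (by nlinarith)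
    have h2 : ‖streamKer h y k E‖ ≤ 3 * (y / 2) / (k - 1 / 2) := by
      refine e1.trans (div_le_div_of_nonneg_right ?_ (by linarith))
      calc _ ≤ (1 + 2 * η) * (y / 2) * 1 := by gcongr
        _ ≤ _ := by nlinarith [H.η_le]
    calc _ ≤ k * (3 * (y / 2) / (k - 1 / 2)) := by gcongr
      _ ≤ 3 * y := by
        rw [← mul_div_assoc, div_le_iff₀ (by linarith)]
        nlinarith
  have e7 : charKer h y k E s - charKer h y k ((k : ℂ) ^ 2) k
      = k * streamKer h y k E * (tKer h y s - tKer h y k)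
        + k * (streamKer h y k E - streamKer h y k ((k : ℂ) ^ 2)) * tKer h y k := by
    unfold charKer; ring
  rw [e7]
  refine (norm_add_le _ _).trans ?_
  rw [norm_mul, norm_mul, norm_mul, norm_mul, Complex.norm_of_nonneg (by linarith : 0 ≤ k)]
  calc _ ≤ 3 * y * (3 * y * ‖s - k‖) + k * (12 * y * ‖E - (k : ℂ) ^ 2‖) * 2 := by gcongr
    _ = _ := by ring

/-- Lowering both decay rates from k to k - δ costs k/(k - δ) ≤ 1 + 2δ and exp(2δy) ≤ exp(2δY), so
the half-line bound survives with a constant near 1 for every k at once. -/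
lemma IsTall.norm_charKer_le (H : IsTall a Y η h) (hy : y ∈ Icc a Y) {k δ : ℝ} {E s : ℂ}
    (hk : 1 ≤ k) (hδ0 : 0 ≤ δ) (hδ : δ ≤ 1 / 2) (hE : (k - δ) ^ 2 ≤ E.re) (hs : k - δ ≤ s.re) :
    ‖charKer h y k E s‖ ≤ (1 + 2 * η) * (1 + η) * (1 + 2 * δ) * Real.exp (2 * δ * Y)
      * ((y / 2) * Real.exp (-(2 * k * y))) := by
  have ha := H.a_pos
  have h0 := H.η_pos
  have hy0 : 0 < y := by linarith [hy.1]
  have e1 := H.norm_streamKer_le hy (c := k - δ) (k := k) (by linarith) (by linarith) hE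
  have e2 := H.norm_tKer_le hy (by linarith : 1 / 2 ≤ s.re)
  have e3 : Real.exp (-(s.re * y)) ≤ Real.exp (-((k - δ) * y)) :=
    Real.exp_le_exp.2 (by nlinarith)
  have e4 : k / (k - δ) ≤ 1 + 2 * δ := by
    rw [div_le_iff₀ (by linarith)]
    nlinarith
  have e5 : Real.exp (-((k - δ) * y)) * Real.exp (-((k - δ) * y))
      ≤ Real.exp (2 * δ * Y) * Real.exp (-(2 * k * y)) := by
    rw [← Real.exp_add, ← Real.exp_add]
    exact Real.exp_le_exp.2 (by nlinarith [hy.2])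
  rw [charKer, norm_mul, norm_mul, Complex.norm_of_nonneg (by linarith : 0 ≤ k)]
  calc _ ≤ k * ((1 + 2 * η) * (y / 2) * Real.exp (-((k - δ) * y)) / (k - δ))
        * ((1 + η) * Real.exp (-((k - δ) * y))) := by
        refine mul_le_mul (mul_le_mul_of_nonneg_left e1 (by linarith))
          (e2.trans (mul_le_mul_of_nonneg_left e3 (by linarith))) (norm_nonneg _)
          (mul_nonneg (by linarith) (div_nonneg (by positivity) (by linarith)))
    _ = (1 + 2 * η) * (1 + η) * (k / (k - δ)) * (y / 2)
        * (Real.exp (-((k - δ) * y)) * Real.exp (-((k - δ) * y))) := by ring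
    _ ≤ (1 + 2 * η) * (1 + η) * (1 + 2 * δ) * (y / 2)
        * (Real.exp (2 * δ * Y) * Real.exp (-(2 * k * y))) := by gcongr
    _ = _ := by ring

/-- The kernel of the characteristic equation at the spectral parameter zero. -/
noncomputable def realCharKer (h y k : ℝ) : ℝ :=
  Real.cosh (k * (h - y)) / Real.sinh (k * h) / 2 *
    (y * (Real.cosh (k * (h - y)) / Real.sinh (k * h))
      - h * (Real.sinh (k * y) / Real.sinh (k * h) ^ 2))

lemma charKer_self {h k : ℝ} (y : ℝ) (hh : 0 < h) (hk : 0 < k) :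
    charKer h y k ((k : ℂ) ^ 2) k = realCharKer h y k := by
  have hk' : (k : ℂ) ≠ 0 := by exact_mod_cast hk.ne'
  rw [charKer, streamKer_self hh hk, gKer, tKer, realCharKer]
  push_cast
  field_simp

/-- The quotient cosh/sinh is at least exp(-ky) without any loss; only the tail term costs η. -/
lemma IsTall.le_realCharKer (H : IsTall a Y η h) (hy : y ∈ Icc a Y) {k : ℝ} (hk : 1 ≤ k) :
    (1 - η) * ((y / 2) * Real.exp (-(2 * k * y))) ≤ realCharKer h y k := by
  have ha := H.a_pos
  have h0 := H.η_pos
  have hp := H.pos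
  have hy0 : 0 < y := by linarith [hy.1]
  have hs : 0 < Real.sinh (k * h) := Real.sinh_pos_iff.2 (by nlinarith)
  have e1 : Real.exp (-(k * y)) ≤ Real.cosh (k * (h - y)) / Real.sinh (k * h) := by
    rw [le_div_iff₀ hs, Real.cosh_eq, Real.sinh_eq]
    have h1 : Real.exp (-(k * y)) * Real.exp (k * h) = Real.exp (k * (h - y)) := by
      rw [← Real.exp_add]; ring_nf
    nlinarith [mul_pos (Real.exp_pos (-(k * y))) (Real.exp_pos (-(k * h))),
      Real.exp_pos (-(k * (h - y)))]
  have e2 : h * (Real.sinh (k * y) / Real.sinh (k * h) ^ 2) ≤ η * y * Real.exp (-(k * y)) := by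
    refine le_trans ?_ (H.tail_le hy (by linarith))
    gcongr
    exact (Real.sinh_lt_cosh _).le
  have e3 : Real.exp (-(2 * k * y)) = Real.exp (-(k * y)) * Real.exp (-(k * y)) := by
    rw [← Real.exp_add]; ring_nf
  rw [realCharKer, e3]
  have hx := Real.exp_pos (-(k * y))
  set X := Real.exp (-(k * y))
  calc (1 - η) * ((y / 2) * (X * X)) = X / 2 * (y * X - η * y * X) := by ring
    _ ≤ _ := by
      refine mul_le_mul (by linarith) ?_ ?_ (by linarith)
      · have := mul_le_mul_of_nonneg_left e1 hy0.le
        linarith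
      · nlinarith [H.η_le, mul_pos hy0 hx]

end bounds

lemma eventually_charKer_const {Y θ : ℝ} (hθ : 0 < θ) :
    ∀ᶠ δ in nhdsWithin (0 : ℝ) (Ioi 0),
      (1 + 2 * δ) * (1 + δ) * (1 + 2 * δ) * Real.exp (2 * δ * Y) ≤ 1 + θ := by
  have : Filter.Tendsto (fun δ : ℝ => (1 + 2 * δ) * (1 + δ) * (1 + 2 * δ) * Real.exp (2 * δ * Y))
      (nhds 0) (nhds 1) := by
    have hc : Continuous
        (fun δ : ℝ => (1 + 2 * δ) * (1 + δ) * (1 + 2 * δ) * Real.exp (2 * δ * Y)) := by fun_prop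
    simpa using hc.tendsto 0
  exact (this.eventually_le_const (by linarith)).filter_mono nhdsWithin_le_nhds

/-! ### Uniqueness for the boundary value problems -/

/-- `d1` and `d2` are the first two derivatives of `d` on `[0, h]`. -/
def HasDerivs (h : ℝ) (d d1 d2 : ℝ → ℂ) : Prop :=
  ∀ y ∈ Icc 0 h, HasDerivWithinAt d (d1 y) (Icc 0 h) y ∧ HasDerivWithinAt d1 (d2 y) (Icc 0 h) y

lemma HasDerivs.of_contDiffOn {h : ℝ} (hh : 0 < h) {d : ℝ → ℂ} (hd : ContDiffOn ℝ 2 d (Icc 0 h)) :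
    HasDerivs h d (derivWithin d (Icc 0 h)) (iteratedDerivWithin 2 d (Icc 0 h)) := by
  intro y hy
  have hu := uniqueDiffOn_Icc hh
  refine ⟨(hd.differentiableOn (by norm_num) y hy).hasDerivWithinAt, ?_⟩
  have h1 : DifferentiableOn ℝ (derivWithin d (Icc 0 h)) (Icc 0 h) :=
    (hd.derivWithin hu (m := 1) (by norm_num)).differentiableOn (by norm_num)
  have := (h1 y hy).hasDerivWithinAt
  rwa [show derivWithin (derivWithin d (Icc 0 h)) (Icc 0 h) y
    = iteratedDerivWithin 2 d (Icc 0 h) y by simp [iteratedDerivWithin_succ']] at this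

lemma HasDerivs.of_hasDerivAt {h : ℝ} {d d1 d2 : ℝ → ℂ} (h1 : ∀ y, HasDerivAt d (d1 y) y)
    (h2 : ∀ y, HasDerivAt d1 (d2 y) y) : HasDerivs h d d1 d2 :=
  fun y _ => ⟨(h1 y).hasDerivWithinAt, (h2 y).hasDerivWithinAt⟩

lemma HasDerivs.sub {h : ℝ} {d d1 d2 e e1 e2 : ℝ → ℂ} (hd : HasDerivs h d d1 d2)
    (he : HasDerivs h e e1 e2) :
    HasDerivs h (fun y => d y - e y) (fun y => d1 y - e1 y) (fun y => d2 y - e2 y) :=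
  fun y hy => ⟨(hd y hy).1.sub (he y hy).1, (hd y hy).2.sub (he y hy).2⟩

lemma HasDerivs.const_mul {h : ℝ} {d d1 d2 : ℝ → ℂ} (hd : HasDerivs h d d1 d2) (c : ℂ) :
    HasDerivs h (fun y => c * d y) (fun y => c * d1 y) (fun y => c * d2 y) :=
  fun y hy => ⟨(hd y hy).1.const_mul c, (hd y hy).2.const_mul c⟩

/-- Energy argument: the real part of d' times the conjugate of d has derivative Re E |d|² + |d'|² ≥
0 and vanishes at both ends under Dirichlet or Neumann conditions. It is therefore constant, and its
derivative is zero. -/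
lemma eq_zero_of_hasDerivs {h : ℝ} {d d1 d2 : ℝ → ℂ} {E : ℂ} (hE : 0 < E.re) (hh : 0 < h)
    (hd : HasDerivs h d d1 d2) (heq : ∀ y ∈ Icc 0 h, d2 y = E * d y)
    (h0 : d 0 = 0 ∨ d1 0 = 0) (h1 : d h = 0 ∨ d1 h = 0) : ∀ y ∈ Icc 0 h, d y = 0 := by
  set F : ℝ → ℝ := fun y => (d1 y * star (d y)).re with hF
  have hder : ∀ y ∈ Icc 0 h, HasDerivWithinAt F (E.re * ‖d y‖ ^ 2 + ‖d1 y‖ ^ 2) (Icc 0 h) y := by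
    intro y hy
    have e1 := ((hd y hy).2.mul (hd y hy).1.star)
    have e2 := (Complex.reCLM.hasFDerivAt.comp_hasDerivWithinAt y e1)
    refine e2.congr_deriv ?_
    rw [heq y hy]
    simp only [Complex.reCLM_apply, Complex.add_re, Complex.star_def]
    rw [mul_assoc, Complex.mul_conj, Complex.mul_conj, ← Complex.sq_norm, ← Complex.sq_norm,
      Complex.re_mul_ofReal, Complex.ofReal_re]
  have hmono : MonotoneOn F (Icc 0 h) := by
    refine monotoneOn_of_hasDerivWithinAt_nonneg (convex_Icc 0 h)
      (fun y hy => (hder y hy).continuousWithinAt)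
      (fun y hy => (hder y (interior_subset hy)).mono interior_subset) (fun y _ => by positivity)
  have hF0 : F 0 = 0 := by rcases h0 with h0 | h0 <;> simp [hF, h0]
  have hF1 : F h = 0 := by rcases h1 with h1 | h1 <;> simp [hF, h1]
  have hz : ∀ y ∈ Icc 0 h, F y = 0 := fun y hy => le_antisymm
    ((hmono hy (right_mem_Icc.2 hh.le) hy.2).trans_eq hF1)
    (hF0.symm.trans_le (hmono (left_mem_Icc.2 hh.le) hy hy.1))
  intro y hy
  have e1 : HasDerivWithinAt F 0 (Icc 0 h) y :=
    (hasDerivWithinAt_const y (Icc 0 h) (0 : ℝ)).congr hz (hz y hy)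
  have e2 := (uniqueDiffOn_Icc hh y hy).eq_deriv _ (hder y hy) e1
  have e3 : E.re * ‖d y‖ ^ 2 = 0 := by
    have : 0 ≤ E.re * ‖d y‖ ^ 2 := by positivity
    nlinarith [sq_nonneg ‖d1 y‖]
  simpa [hE.ne'] using e3

/-! ### Kernels as functions of y -/

section kernels
variable {h : ℝ} {m : ℂ}

lemma hasDerivAt_csinh_comp {u : ℝ → ℂ} {u' : ℂ} {y : ℝ} (hu : HasDerivAt u u' y) :
    HasDerivAt (fun y => Complex.sinh (u y)) (Complex.cosh (u y) * u') y :=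
  (Complex.hasDerivAt_sinh (u y)).comp y hu

lemma hasDerivAt_ccosh_comp {u : ℝ → ℂ} {u' : ℂ} {y : ℝ} (hu : HasDerivAt u u' y) :
    HasDerivAt (fun y => Complex.cosh (u y)) (Complex.sinh (u y) * u') y :=
  (Complex.hasDerivAt_cosh (u y)).comp y hu

lemma hasDerivAt_ofReal (y : ℝ) : HasDerivAt (fun y : ℝ => (y : ℂ)) 1 y :=
  Complex.ofRealCLM.hasDerivAt

lemma hasDerivAt_linear (h y : ℝ) (m : ℂ) :
    HasDerivAt (fun y : ℝ => m * ((h : ℂ) - y)) (-m) y := by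
  simpa using ((Complex.ofRealCLM.hasDerivAt (x := y)).const_sub (h : ℂ)).const_mul m

lemma hasDerivAt_sKer_space (h y : ℝ) (m : ℂ) :
    HasDerivAt (fun y => sKer h y m) (-m * tKer h y m) y := by
  refine ((hasDerivAt_csinh_comp (hasDerivAt_linear h y m)).div_const _).congr_deriv ?_
  unfold tKer; ring

lemma hasDerivAt_tKer_space (h y : ℝ) (m : ℂ) :
    HasDerivAt (fun y => tKer h y m) (-m * sKer h y m) y := by
  refine ((hasDerivAt_ccosh_comp (hasDerivAt_linear h y m)).div_const _).congr_deriv ?_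
  unfold sKer; ring

lemma hasDerivs_sKer (h : ℝ) (m : ℂ) :
    HasDerivs h (fun y => sKer h y m) (fun y => -m * tKer h y m) (fun y => m ^ 2 * sKer h y m) :=
  HasDerivs.of_hasDerivAt (fun y => hasDerivAt_sKer_space h y m)
    fun y => ((hasDerivAt_tKer_space h y m).const_mul (-m)).congr_deriv (by ring)

lemma sKer_zero (hh : 0 < h) (hm : 0 < m.re) : sKer h 0 m = 1 := by
  rw [sKer, Complex.ofReal_zero, sub_zero, div_self (sinh_mul_ofReal_ne_zero hm hh)]

lemma sKer_top (h : ℝ) (m : ℂ) : sKer h h m = 0 := by simp [sKer]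

/-- The derivative of `gKer` in `y`. -/
noncomputable def gKerDeriv (h y : ℝ) (m : ℂ) : ℂ :=
  (tKer h y m - y * m * sKer h y m
    - h * (m * Complex.cosh (m * y) / Complex.sinh (m * h) ^ 2)) / (2 * m)

lemma hasDerivAt_gKer_space (h y : ℝ) (m : ℂ) :
    HasDerivAt (fun y => gKer h y m) (gKerDeriv h y m) y := by
  have e1 := (hasDerivAt_ofReal y).mul (hasDerivAt_tKer_space h y m)
  have e2 := (((hasDerivAt_csinh_comp ((hasDerivAt_ofReal y).const_mul m)).div_const
    (Complex.sinh (m * h) ^ 2)).const_mul (h : ℂ))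
  refine ((e1.sub e2).div_const (2 * m)).congr_deriv ?_
  unfold gKerDeriv; ring

lemma hasDerivAt_gKerDeriv (h y : ℝ) {m : ℂ} (hm : m ≠ 0) :
    HasDerivAt (fun y => gKerDeriv h y m) (m ^ 2 * gKer h y m - sKer h y m) y := by
  have e1 := ((hasDerivAt_ofReal y).mul_const m).mul (hasDerivAt_sKer_space h y m)
  have e2 := ((((hasDerivAt_ccosh_comp ((hasDerivAt_ofReal y).const_mul m)).const_mul m).div_const
    (Complex.sinh (m * h) ^ 2)).const_mul (h : ℂ))
  refine ((((hasDerivAt_tKer_space h y m).sub e1).sub e2).div_const (2 * m)).congr_deriv ?_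
  unfold gKer
  field_simp
  ring

/-- Off resonance, subtract the solutions for the parameters k² and E and divide by E - k². At
resonance E = k² the quotient becomes the parameter derivative `gKer`. -/
lemma exists_hasDerivs_streamKer (hh : 0 < h) {k : ℝ} (hk : 0 < k) (E : ℂ) :
    ∃ d1, HasDerivs h (fun y => streamKer h y k E) d1
      (fun y => (k : ℂ) ^ 2 * streamKer h y k E - sKer h y (csqrt E)) := by
  by_cases hE : E = (k : ℂ) ^ 2
  · have hk' : (k : ℂ) ≠ 0 := by exact_mod_cast hk.ne'
    subst hE
    refine ⟨fun y => gKerDeriv h y k, HasDerivs.of_hasDerivAt (fun y => ?_) fun y => ?_⟩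
    · simp only [streamKer_self hh hk]
      exact hasDerivAt_gKer_space h y k
    · simp only [streamKer_self hh hk, csqrt_sq_ofReal hk.le]
      exact hasDerivAt_gKerDeriv h y hk'
  · have hE' : E - (k : ℂ) ^ 2 ≠ 0 := sub_ne_zero.2 hE
    have := (((hasDerivs_sKer h k).sub (hasDerivs_sKer h (csqrt E))).const_mul
      (E - (k : ℂ) ^ 2)⁻¹)
    refine ⟨_, fun y hy => ⟨(this y hy).1.congr (fun z _ => ?_) ?_, (this y hy).2.congr_deriv ?_⟩⟩
    · rw [streamKer_of_ne hk hE]; ring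
    · rw [streamKer_of_ne hk hE]; ring
    · simp only [streamKer_of_ne hk hE, csqrt_sq]; field_simp; ring

lemma streamKer_zero (hh : 0 < h) {k : ℝ} (hk : 0 < k) {E : ℂ} (hE : 0 < (csqrt E).re) :
    streamKer h 0 k E = 0 := by
  by_cases hEk : E = (k : ℂ) ^ 2
  · rw [hEk, streamKer_self hh hk]; simp [gKer]
  · rw [streamKer_of_ne hk hEk, sKer_zero hh hE, sKer_zero hh (by simpa using hk)]; simp

lemma streamKer_top (hh : 0 < h) {k : ℝ} (hk : 0 < k) (E : ℂ) : streamKer h h k E = 0 := by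
  by_cases hEk : E = (k : ℂ) ^ 2
  · have hs : Complex.sinh ((k : ℂ) * h) ≠ 0 := sinh_mul_ofReal_ne_zero (by simpa using hk) hh
    rw [hEk, streamKer_self hh hk, gKer, tKer]
    simp
    left
    field_simp
    simp
  · rw [streamKer_of_ne hk hEk, sKer_top, sKer_top]; simp

end kernels

/-! ### The characteristic equation -/

/-- The characteristic function: for an eigenvalue `E = k² + lam / ν`, `s² = k² + lam`, one has
`charFun h k f E s = s / k`. -/
noncomputable def charFun (h k : ℝ) (f : ℝ → ℝ) (E s : ℂ) : ℂ :=
  ∫ y in (0:ℝ)..h, (f y : ℂ) * charKer h y k E s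

lemma csqrt_re_pos {E : ℂ} (hE : 0 < E.re) : 0 < (csqrt E).re :=
  (Real.sqrt_pos.2 hE).trans_le (le_csqrt_re (by rw [Real.sq_sqrt hE.le]))

lemma HasDerivs.continuousOn {h : ℝ} {d d1 d2 : ℝ → ℂ} (hd : HasDerivs h d d1 d2) :
    ContinuousOn d (Icc 0 h) := fun y hy => (hd y hy).1.continuousWithinAt

lemma continuousOn_charKer {h k : ℝ} (hh : 0 < h) (hk : 0 < k) (E s : ℂ) :
    ContinuousOn (fun y => charKer h y k E s) (Icc 0 h) := by
  obtain ⟨d1, hd⟩ := exists_hasDerivs_streamKer hh hk E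
  have e2 : Continuous (fun y => tKer h y s) :=
    continuous_iff_continuousAt.2 fun y => (hasDerivAt_tKer_space h y s).continuousAt
  exact (continuousOn_const.mul hd.continuousOn).mul e2.continuousOn

section characteristic
variable {ν h : ℝ} {U f : ℝ → ℝ} {k : ℕ} {lam : ℂ}

lemma derivWithin_profile (hh : 0 < h) (hU : ∀ y, HasDerivAt U (f y) y) {y : ℝ}
    (hy : y ∈ Icc 0 h) : derivWithin U (Icc 0 h) y = f y :=
  (hU y).hasDerivWithinAt.derivWithin (uniqueDiffOn_Icc hh y hy)

/-- Uniqueness gives om and psi as w(0) times explicit kernels. Integrating the derivative of the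
Wronskian of w and `tKer` over [0, h] then leaves only the boundary term s w(0). -/
lemma charFun_eq_of_isEigenvalue (hh : 0 < h) (hk : 1 ≤ k)
    (hU : ∀ y, HasDerivAt U (f y) y) (hf : Continuous f)
    (hE : 0 < ((k : ℂ) ^ 2 + lam / ν).re) (hs : 0 < ((k : ℂ) ^ 2 + lam).re)
    (hev : IsEigenvalue ν h U k lam) :
    charFun h k f ((k : ℂ) ^ 2 + lam / ν) (csqrt ((k : ℂ) ^ 2 + lam))
      = csqrt ((k : ℂ) ^ 2 + lam) / k := by
  obtain ⟨om, psi, w, M, hne⟩ := hev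
  have hk0 : (0 : ℝ) < k := by exact_mod_cast hk
  have hkC : (k : ℂ) ≠ 0 := by exact_mod_cast hk0.ne'
  have hE' := csqrt_re_pos hE
  have hs' := csqrt_re_pos hs
  set E := (k : ℂ) ^ 2 + lam / ν with hEdef
  set s := csqrt ((k : ℂ) ^ 2 + lam) with hsdef
  have hk2 : 0 < ((k : ℂ) ^ 2).re := by
    rw [← Complex.ofReal_natCast, ← Complex.ofReal_pow, Complex.ofReal_re]; positivity
  have dom := HasDerivs.of_contDiffOn hh M.smooth_om
  have dpsi := HasDerivs.of_contDiffOn hh M.smooth_psi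
  have dw := HasDerivs.of_contDiffOn hh M.smooth_w
  set c : ℂ := Complex.I * k * w 0 with hc
  have hom : ∀ y ∈ Icc 0 h, om y = c * sKer h y (csqrt E) := by
    intro y hy
    refine sub_eq_zero.1 (eq_zero_of_hasDerivs hE hh
      (dom.sub ((hasDerivs_sKer h (csqrt E)).const_mul c)) (fun z hz => ?_) (Or.inl ?_)
      (Or.inl ?_) y hy)
    · have := M.eq_om z hz
      rw [csqrt_sq]
      linear_combination this
    · rw [sKer_zero hh hE', M.om_bot]; ring
    · rw [sKer_top, M.om_top]; ring
  obtain ⟨g1, dG⟩ := exists_hasDerivs_streamKer hh hk0 E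
  have hpsi : ∀ y ∈ Icc 0 h, psi y = c * streamKer h y k E := by
    intro y hy
    refine sub_eq_zero.1 (eq_zero_of_hasDerivs hk2 hh (dpsi.sub (dG.const_mul c))
      (fun z hz => ?_) (Or.inl ?_) (Or.inl ?_) y hy)
    · have e1 := M.eq_psi z hz
      have e2 := hom z hz
      push_cast
      linear_combination e1 - e2
    · rw [streamKer_zero hh hk0 hE', M.psi_bot]; ring
    · rw [streamKer_top hh hk0, M.psi_top]; ring
  -- Otherwise om and psi vanish and w solves a homogeneous Neumann problem, so the mode is trivial.
  have hw0 : w 0 ≠ 0 := by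
    intro hw
    have hc0 : c = 0 := by rw [hc, hw, mul_zero]
    have hwz := eq_zero_of_hasDerivs hs hh dw (fun z hz => ?_) (Or.inr M.w_bot) (Or.inr M.w_top)
    · obtain ⟨y, hy, h1 | h1⟩ := hne
      · exact h1 (by rw [hom y hy, hc0, zero_mul])
      · exact h1 (hwz y hy)
    · have := M.eq_w z hz
      rw [hpsi z hz, hc0] at this
      linear_combination this
  have hW : ∀ y ∈ Icc 0 h, HasDerivWithinAt
      (fun y => derivWithin w (Icc 0 h) y * tKer h y s - w y * (-s * sKer h y s))
      (-(k * w 0) * ((f y : ℂ) * charKer h y k E s)) (Icc 0 h) y := by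
    intro y hy
    have e1 := ((dw y hy).2.mul (hasDerivAt_tKer_space h y s).hasDerivWithinAt).sub
      ((dw y hy).1.mul ((hasDerivAt_sKer_space h y s).hasDerivWithinAt.const_mul (-s)))
    refine e1.congr_deriv ?_
    have e2 := M.eq_w y hy
    rw [hpsi y hy, derivWithin_profile hh hU hy] at e2
    have e3 : s ^ 2 = (k : ℂ) ^ 2 + lam := csqrt_sq _
    have e4 := Complex.I_sq
    unfold charKer
    rw [hc] at e2
    push_cast
    linear_combination tKer h y s * e2 - w y * tKer h y s * e3
      + (k : ℂ) ^ 2 * f y * w 0 * streamKer h y k E * tKer h y s * e4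
  have hcont : ContinuousOn (fun y => (f y : ℂ) * charKer h y k E s) (Icc 0 h) :=
    (Complex.continuous_ofReal.comp hf).continuousOn.mul (continuousOn_charKer hh hk0 E s)
  have hint := intervalIntegral.integral_eq_sub_of_hasDerivAt_of_le hh.le
    (fun y hy => (hW y hy).continuousWithinAt)
    (fun y hy => (hW y (Ioo_subset_Icc_self hy)).hasDerivAt (Icc_mem_nhds hy.1 hy.2))
    ((continuousOn_const.mul hcont).intervalIntegrable_of_Icc hh.le)
  rw [intervalIntegral.integral_const_mul, M.w_top, M.w_bot, sKer_top, sKer_zero hh hs'] at hint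
  change -(k * w 0) * charFun h k f E s = _ at hint
  rw [eq_div_iff hkC]
  have : w 0 * (charFun h k f E s * k - s) = 0 := by linear_combination -hint
  exact sub_eq_zero.1 ((mul_eq_zero.1 this).resolve_left hw0)

lemma contDiff_two_of_hasDerivAt {d d1 d2 : ℝ → ℂ} (h1 : ∀ y, HasDerivAt d (d1 y) y)
    (h2 : ∀ y, HasDerivAt d1 (d2 y) y) (hc : Continuous d2) : ContDiff ℝ 2 d := by
  have e1 : deriv d = d1 := funext fun y => (h1 y).deriv
  have e2 : deriv d1 = d2 := funext fun y => (h2 y).deriv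
  rw [show (2 : WithTop ℕ∞) = 1 + 1 by norm_num, contDiff_succ_iff_deriv]
  refine ⟨fun y => (h1 y).differentiableAt, by simp, ?_⟩
  rw [e1, contDiff_one_iff_deriv, e2]
  exact ⟨fun y => (h2 y).differentiableAt, hc⟩

lemma iteratedDerivWithin_two_of_hasDerivAt {d d1 d2 : ℝ → ℂ} (hh : 0 < h)
    (h1 : ∀ y, HasDerivAt d (d1 y) y) (h2 : ∀ y, HasDerivAt d1 (d2 y) y) {y : ℝ}
    (hy : y ∈ Icc 0 h) : iteratedDerivWithin 2 d (Icc 0 h) y = d2 y := by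
  have hu := uniqueDiffOn_Icc hh
  have e1 : ∀ z ∈ Icc 0 h, derivWithin d (Icc 0 h) z = d1 z :=
    fun z hz => (h1 z).hasDerivWithinAt.derivWithin (hu z hz)
  have : derivWithin (derivWithin d (Icc 0 h)) (Icc 0 h) y = d2 y := by
    rw [derivWithin_congr e1 (e1 y hy)]
    exact (h2 y).hasDerivWithinAt.derivWithin (hu y hy)
  simpa [iteratedDerivWithin_succ'] using this

/-- Solution of `w'' - k² w = F` with `w 0 = 1`, `w' 0 = 0`, by variation of parameters. -/
lemma exists_hasDerivAt_of_forcing {k : ℂ} (hk : k ≠ 0) {F : ℝ → ℂ} (hF : Continuous F) :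
    ∃ w w1 : ℝ → ℂ, (∀ y, HasDerivAt w (w1 y) y) ∧
      (∀ y, HasDerivAt w1 (k ^ 2 * w y + F y) y) ∧ w 0 = 1 ∧ w1 0 = 0 ∧
      ∀ h : ℝ, w1 h = k * Complex.sinh (k * h)
        + ∫ z in (0:ℝ)..h, Complex.cosh (k * (h - z)) * F z := by
  have hs : ∀ y : ℝ, HasDerivAt (fun y : ℝ => Complex.sinh (k * y)) (Complex.cosh (k * y) * k) y :=
    fun y => (hasDerivAt_csinh_comp ((hasDerivAt_ofReal y).const_mul k)).congr_deriv (by ring)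
  have hc : ∀ y : ℝ, HasDerivAt (fun y : ℝ => Complex.cosh (k * y)) (Complex.sinh (k * y) * k) y :=
    fun y => (hasDerivAt_ccosh_comp ((hasDerivAt_ofReal y).const_mul k)).congr_deriv (by ring)
  have cs : Continuous (fun y : ℝ => Complex.sinh (k * y) * F y) :=
    (continuous_iff_continuousAt.2 fun y => (hs y).continuousAt).mul hF
  have cc : Continuous (fun y : ℝ => Complex.cosh (k * y) * F y) :=
    (continuous_iff_continuousAt.2 fun y => (hc y).continuousAt).mul hF
  set I1 : ℝ → ℂ := fun y => ∫ z in (0:ℝ)..y, Complex.cosh (k * z) * F z with hI1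
  set I2 : ℝ → ℂ := fun y => ∫ z in (0:ℝ)..y, Complex.sinh (k * z) * F z with hI2
  have d1 : ∀ y : ℝ, HasDerivAt I1 (Complex.cosh (k * y) * F y) y := fun y =>
    intervalIntegral.integral_hasDerivAt_right (cc.intervalIntegrable _ _)
      cc.aestronglyMeasurable.stronglyMeasurableAtFilter cc.continuousAt
  have d2 : ∀ y : ℝ, HasDerivAt I2 (Complex.sinh (k * y) * F y) y := fun y =>
    intervalIntegral.integral_hasDerivAt_right (cs.intervalIntegrable _ _)
      cs.aestronglyMeasurable.stronglyMeasurableAtFilter cs.continuousAt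
  refine ⟨fun y => Complex.cosh (k * y)
      + (1 / k) * (Complex.sinh (k * y) * I1 y - Complex.cosh (k * y) * I2 y),
    fun y => k * Complex.sinh (k * y)
      + (Complex.cosh (k * y) * I1 y - Complex.sinh (k * y) * I2 y), fun y => ?_, fun y => ?_,
    by simp [hI1, hI2], by simp [hI1, hI2], fun h => ?_⟩
  · refine ((hc y).add ((((hs y).mul (d1 y)).sub ((hc y).mul (d2 y))).const_mul
      (1 / k))).congr_deriv ?_
    field_simp
    ring
  · refine (((hs y).const_mul k).add (((hc y).mul (d1 y)).sub ((hs y).mul (d2 y)))).congr_deriv ?_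
    have := Complex.cosh_sq_sub_sinh_sq (k * y)
    field_simp
    linear_combination F y * this
  · have e : ∀ z : ℝ, Complex.cosh (k * (h - z)) * F z
        = Complex.cosh (k * h) * (Complex.cosh (k * z) * F z)
          - Complex.sinh (k * h) * (Complex.sinh (k * z) * F z) := by
      intro z
      rw [mul_sub, Complex.cosh_sub]; ring
    simp only [e]
    rw [intervalIntegral.integral_sub ((cc.intervalIntegrable _ _).const_mul _)
      ((cs.intervalIntegrable _ _).const_mul _), intervalIntegral.integral_const_mul,
      intervalIntegral.integral_const_mul]

/-- Shooting from y = 0 with w = 1 and w' = 0 meets every condition except w'(h) = 0. By variation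
of parameters w'(h) is k sinh(kh) times 1 - `charFun`. -/
lemma isEigenvalue_zero_of_charFun (hh : 0 < h) (hk : 1 ≤ k)
    (hU : ∀ y, HasDerivAt U (f y) y) (hf : Continuous f)
    (hchar : charFun h k f ((k : ℂ) ^ 2) k = 1) : IsEigenvalue ν h U k 0 := by
  have hk0 : (0 : ℝ) < k := by exact_mod_cast hk
  have hkC : (k : ℂ) ≠ 0 := by exact_mod_cast hk0.ne'
  have hre : 0 < (k : ℂ).re := by simpa using hk0
  have cg : Continuous (fun y => gKer h y k) :=
    continuous_iff_continuousAt.2 fun y => (hasDerivAt_gKer_space h y k).continuousAt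
  have cs : Continuous (fun y => sKer h y k) :=
    continuous_iff_continuousAt.2 fun y => (hasDerivAt_sKer_space h y k).continuousAt
  have hF : Continuous (fun y => -(k : ℂ) ^ 2 * (f y * gKer h y k)) :=
    continuous_const.mul ((Complex.continuous_ofReal.comp hf).mul cg)
  obtain ⟨w, w1, dw, dw1, hw0, hw10, hw1⟩ := exists_hasDerivAt_of_forcing hkC hF
  have cw : Continuous w := continuous_iff_continuousAt.2 fun y => (dw y).continuousAt
  have ds : ∀ y, HasDerivAt (fun y => Complex.I * k * sKer h y k)
      (Complex.I * k * (-k * tKer h y k)) y :=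
    fun y => (hasDerivAt_sKer_space h y k).const_mul _
  have ds1 : ∀ y, HasDerivAt (fun y => Complex.I * k * (-k * tKer h y k))
      (Complex.I * k * (k ^ 2 * sKer h y k)) y :=
    fun y => (((hasDerivAt_tKer_space h y k).const_mul (-(k : ℂ))).const_mul _).congr_deriv
      (by ring)
  have dg : ∀ y, HasDerivAt (fun y => Complex.I * k * gKer h y k)
      (Complex.I * k * gKerDeriv h y k) y :=
    fun y => (hasDerivAt_gKer_space h y k).const_mul _
  have dg1 : ∀ y, HasDerivAt (fun y => Complex.I * k * gKerDeriv h y k)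
      (Complex.I * k * (k ^ 2 * gKer h y k - sKer h y k)) y :=
    fun y => (hasDerivAt_gKerDeriv h y hkC).const_mul _
  have hu := uniqueDiffOn_Icc hh
  have hG : ∀ y, gKer h y k = streamKer h y k ((k : ℂ) ^ 2) := fun y => by
    have := streamKer_self (y := y) hh hk0
    push_cast at this
    exact this.symm
  refine ⟨fun y => Complex.I * k * sKer h y k, fun y => Complex.I * k * gKer h y k, w, ?_,
    0, left_mem_Icc.2 hh.le, Or.inr (by rw [hw0]; exact one_ne_zero)⟩
  constructor
  · exact (contDiff_two_of_hasDerivAt ds ds1 (by fun_prop)).contDiffOn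
  · exact (contDiff_two_of_hasDerivAt dg dg1 (by fun_prop)).contDiffOn
  · exact (contDiff_two_of_hasDerivAt dw dw1 (by fun_prop)).contDiffOn
  · intro y hy
    rw [iteratedDerivWithin_two_of_hasDerivAt hh ds ds1 hy, zero_div]
    ring
  · intro y hy
    rw [iteratedDerivWithin_two_of_hasDerivAt hh dg dg1 hy]
    ring
  · intro y hy
    rw [iteratedDerivWithin_two_of_hasDerivAt hh dw dw1 hy, derivWithin_profile hh hU hy]
    linear_combination -(k : ℂ) ^ 2 * f y * gKer h y k * Complex.I_sq
  · simp [sKer_top]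
  · simp only [sKer_zero hh hre, hw0]
  · rw [hG]
    have := streamKer_top hh hk0 ((k : ℂ) ^ 2)
    rw [this, mul_zero]
  · simp [gKer]
  · rw [(dw h).hasDerivWithinAt.derivWithin (hu h (right_mem_Icc.2 hh.le)), hw1]
    have hsn : Complex.sinh ((k : ℂ) * h) ≠ 0 := sinh_mul_ofReal_ne_zero hre hh
    have e : ∀ z : ℝ, Complex.cosh ((k : ℂ) * (h - z)) * (-(k : ℂ) ^ 2 * (f z * gKer h z k))
        = -(k * Complex.sinh ((k : ℂ) * h)) * ((f z : ℂ) * charKer h z k ((k : ℂ) ^ 2) k) := by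
      intro z
      rw [charKer, ← hG, tKer]
      push_cast
      field_simp
    simp only [e]
    rw [intervalIntegral.integral_const_mul]
    change _ + -(k * Complex.sinh ((k : ℂ) * h)) * charFun h k f ((k : ℂ) ^ 2) k = 0
    rw [hchar]; ring
  · rw [(dw 0).hasDerivWithinAt.derivWithin (hu 0 (left_mem_Icc.2 hh.le)), hw10]

end characteristic

/-! ### Bumps and averages against them -/

/-- A smooth nonnegative function supported in `[a, b]` of unit mass with respect to `y / 2`. -/
structure IsUnitBump (a b : ℝ) (φ : ℝ → ℝ) : Prop where
  smooth : ContDiff ℝ ∞ φ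
  nonneg : ∀ y, 0 ≤ φ y
  eq_zero : ∀ y, y ∉ Icc a b → φ y = 0
  integral : ∀ h, b ≤ h → ∫ y in (0:ℝ)..h, φ y * (y / 2) = 1

lemma exists_isUnitBump {a b : ℝ} (ha : 0 < a) (hab : a < b) : ∃ φ, IsUnitBump a b φ := by
  let β : ContDiffBump ((a + b) / 2) := ⟨(b - a) / 4, (b - a) / 2, by linarith, by linarith⟩
  have hβ : ContDiff ℝ ∞ β := β.contDiff
  have h0 : ∀ y, 0 ≤ β y := fun y => β.nonneg
  have hz : ∀ y, y ∉ Icc a b → β y = 0 := by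
    intro y hy
    refine β.zero_of_le_dist ?_
    rw [Real.dist_eq]
    by_contra hlt
    obtain ⟨h1, h2⟩ := abs_lt.1 (not_le.1 hlt)
    change -((b - a) / 2) < _ at h1
    change _ < (b - a) / 2 at h2
    exact hy ⟨by linarith, by linarith⟩
  have hc : Continuous fun y => β y * (y / 2) := by
    have := hβ.continuous
    fun_prop
  have hpos : 0 < ∫ y in (0:ℝ)..b, β y * (y / 2) := by
    refine intervalIntegral.integral_pos (by linarith) hc.continuousOn
      (fun y hy => mul_nonneg (h0 y) (by linarith [hy.1])) ⟨(a + b) / 2, ⟨by linarith, by linarith⟩, ?_⟩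
    have : β ((a + b) / 2) = 1 := β.one_of_mem_closedBall (Metric.mem_closedBall_self
      (by change 0 ≤ (b - a) / 4; linarith))
    rw [this]
    linarith
  set I := ∫ y in (0:ℝ)..b, β y * (y / 2) with hI
  refine ⟨fun y => I⁻¹ * β y, contDiff_const.mul hβ,
    fun y => mul_nonneg (inv_nonneg.2 hpos.le) (h0 y), fun y hy => by rw [hz y hy, mul_zero],
    fun h hh => ?_⟩
  simp only [mul_assoc]
  rw [intervalIntegral.integral_const_mul, ← intervalIntegral.integral_add_adjacent_intervals
    (hc.intervalIntegrable 0 b) (hc.intervalIntegrable b h), ← hI]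
  have : ∫ y in b..h, β y * (y / 2) = 0 := by
    rw [intervalIntegral.integral_of_le hh]
    refine MeasureTheory.setIntegral_eq_zero_of_forall_eq_zero fun y hy => ?_
    rw [hz y (fun h' => absurd hy.1 (not_lt.2 h'.2)), zero_mul]
  rw [this, add_zero, inv_mul_cancel₀ hpos.ne']

section averages
variable {a b h C : ℝ} {φ : ℝ → ℝ}

/-- On [0, h], φ(y) y/2 is a probability density, so a bound on K relative to y/2 passes to the
integral with the same constant. -/
lemma IsUnitBump.norm_integral_le (hφ : IsUnitBump a b φ) (h0 : 0 ≤ h) (hb : b ≤ h) {K : ℝ → ℂ}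
    (hK : ∀ y ∈ Icc a b, ‖K y‖ ≤ C * (y / 2)) :
    ‖∫ y in (0:ℝ)..h, (φ y : ℂ) * K y‖ ≤ C := by
  have hc := hφ.smooth.continuous
  have key := intervalIntegral.norm_integral_le_of_norm_le (μ := MeasureTheory.volume) h0
    (f := fun y => (φ y : ℂ) * K y) (g := fun y => C * (φ y * (y / 2)))
    (Filter.Eventually.of_forall fun y _ => ?_)
    ((show Continuous fun y => C * (φ y * (y / 2)) by fun_prop).intervalIntegrable _ _)
  · rwa [intervalIntegral.integral_const_mul, hφ.integral h hb, mul_one] at key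
  · by_cases hy' : y ∈ Icc a b
    · rw [norm_mul, Complex.norm_of_nonneg (hφ.nonneg y)]
      have := mul_le_mul_of_nonneg_left (hK y hy') (hφ.nonneg y)
      linarith
    · rw [hφ.eq_zero y hy']; simp

lemma IsUnitBump.integral_le (hφ : IsUnitBump a b φ) (h0 : 0 ≤ h) (hb : b ≤ h) {K : ℝ → ℝ}
    (hKc : ContinuousOn K (Icc 0 h)) (hK : ∀ y ∈ Icc a b, K y ≤ C * (y / 2)) :
    ∫ y in (0:ℝ)..h, φ y * K y ≤ C := by
  have hc := hφ.smooth.continuous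
  have key := intervalIntegral.integral_mono_on (μ := MeasureTheory.volume) h0
    (f := fun y => φ y * K y) (g := fun y => C * (φ y * (y / 2)))
    ((hc.continuousOn.mul hKc).intervalIntegrable_of_Icc h0)
    ((show Continuous fun y => C * (φ y * (y / 2)) by fun_prop).intervalIntegrable _ _)
    (fun y _ => ?_)
  · rwa [intervalIntegral.integral_const_mul, hφ.integral h hb, mul_one] at key
  · by_cases hy' : y ∈ Icc a b
    · have := mul_le_mul_of_nonneg_left (hK y hy') (hφ.nonneg y)
      linarith
    · rw [hφ.eq_zero y hy']; simp

lemma IsUnitBump.le_integral (hφ : IsUnitBump a b φ) (h0 : 0 ≤ h) (hb : b ≤ h) {K : ℝ → ℝ}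
    (hKc : ContinuousOn K (Icc 0 h)) (hK : ∀ y ∈ Icc a b, C * (y / 2) ≤ K y) :
    C ≤ ∫ y in (0:ℝ)..h, φ y * K y := by
  have := hφ.integral_le h0 hb (K := fun y => -K y) (C := -C) hKc.neg
    (fun y hy => by linarith [hK y hy])
  simp only [mul_neg, intervalIntegral.integral_neg] at this
  linarith

end averages

/-! ### The linear system for the coefficients -/

/-- A linear system with a diagonally dominant matrix. -/
lemma exists_mulVec_eq {ι : Type*} [Fintype ι] [DecidableEq ι] {M : Matrix ι ι ℝ} {v : ι → ℝ}
    {ρ : ℝ} (hd : ∀ i, 1 / 2 ≤ M i i)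
    (ho : ∀ i, ∑ j ∈ Finset.univ.erase i, |M i j| ≤ 1 / 4) (hv : ∀ i, |v i| ≤ ρ) :
    ∃ x, M.mulVec x = v ∧ ∀ j, |x j| ≤ 4 * ρ := by
  have hdet : M.det ≠ 0 := by
    refine det_ne_zero_of_sum_row_lt_diag fun i => ?_
    simp only [Real.norm_eq_abs]
    have := le_abs_self (M i i)
    linarith [ho i, hd i]
  have hx : M.mulVec (M⁻¹.mulVec v) = v := by
    rw [Matrix.mulVec_mulVec, Matrix.mul_nonsing_inv _ (isUnit_iff_ne_zero.2 hdet),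
      Matrix.one_mulVec]
  refine ⟨M⁻¹.mulVec v, hx, fun j => ?_⟩
  set x := M⁻¹.mulVec v
  -- In the row where |x i| is maximal, dominance gives |x i|/2 ≤ ρ + |x i|/4.
  obtain ⟨i, -, hi⟩ := Finset.exists_max_image Finset.univ (fun i => |x i|) ⟨j, Finset.mem_univ j⟩
  refine (hi j (Finset.mem_univ j)).trans ?_
  have e1 : M i i * x i = v i - ∑ j ∈ Finset.univ.erase i, M i j * x j := by
    rw [← congrFun hx i, Matrix.mulVec, dotProduct, ← Finset.add_sum_erase _ _ (Finset.mem_univ i)]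
    ring
  have e2 : |∑ j ∈ Finset.univ.erase i, M i j * x j| ≤ 1 / 4 * |x i| := by
    refine (Finset.abs_sum_le_sum_abs _ _).trans ?_
    refine le_trans (Finset.sum_le_sum (g := fun j => |M i j| * |x i|) fun j _ => ?_) ?_
    · rw [abs_mul]
      exact mul_le_mul_of_nonneg_left (hi j (Finset.mem_univ j)) (abs_nonneg _)
    · rw [← Finset.sum_mul]
      exact mul_le_mul_of_nonneg_right (ho i) (abs_nonneg _)
  have e3 : |M i i * x i| ≤ ρ + 1 / 4 * |x i| := by
    rw [e1]
    exact (abs_sub _ _).trans (add_le_add (hv i) e2)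
  rw [abs_mul, abs_of_nonneg (by linarith [hd i])] at e3
  have := mul_le_mul_of_nonneg_right (hd i) (abs_nonneg (x i))
  linarith

/-- The logarithm of the size of the `j`-th coefficient. -/
noncomputable def coeffExponent (N : ℕ) (B : ℝ) (j : Fin N) : ℝ :=
  B * (2 * (N + 1) * ((j : ℝ) + 1) - ((j : ℝ) + 1) ^ 2)

/-- Bumps at the points B(j + 1) give entries comparable to exp(-2kB(j + 1)). Rescaling rows and
columns turns these into exp(-B(i - j)²), which is diagonally dominant for large B; undoing the
column scaling gives the size of the coefficients. -/
lemma exists_coeff {N : ℕ} {B ρ : ℝ} (hB : 0 ≤ B) (hBN : 8 * N * Real.exp (-B) ≤ 1)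
    {A : ℕ → Fin N → ℝ} {r : ℕ → ℝ}
    (hA : ∀ k ∈ Finset.Icc 1 N, ∀ j : Fin N,
      1 / 2 * Real.exp (-(2 * k * (B * ((j : ℝ) + 1)))) ≤ A k j ∧
        A k j ≤ 2 * Real.exp (-(2 * k * (B * ((j : ℝ) + 1)))))
    (hr : ∀ k ∈ Finset.Icc 1 N, |r k| ≤ ρ) :
    ∃ c : Fin N → ℝ, (∀ k ∈ Finset.Icc 1 N, ∑ j, c j * A k j = r k) ∧
      ∀ j, |c j| ≤ 4 * ρ * Real.exp (coeffExponent N B j) := by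
  have hk : ∀ i : Fin N, N - (i : ℕ) ∈ Finset.Icc 1 N := fun i => by
    rw [Finset.mem_Icc]; omega
  have hcast : ∀ i : Fin N, ((N - (i : ℕ) : ℕ) : ℝ) = N - i := fun i =>
    Nat.cast_sub i.2.le
  set R : Fin N → ℝ := fun i => Real.exp (-(B * ((i : ℝ) + 1) ^ 2)) with hR
  have hRpos : ∀ i, 0 < R i := fun i => Real.exp_pos _
  -- Completing the square. Row i carries the wave number N - i, so the N + 1 in `coeffExponent`
  -- leaves the cross term 2B(i + 1)(j + 1).
  have hexp : ∀ i j : Fin N, R i * Real.exp (-(2 * ((N - (i : ℕ) : ℕ) : ℝ) * (B * ((j : ℝ) + 1))))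
      * Real.exp (coeffExponent N B j) = Real.exp (-(B * ((i : ℝ) - j) ^ 2)) := by
    intro i j
    rw [hR, ← Real.exp_add, ← Real.exp_add, hcast, coeffExponent]
    congr 1; ring
  set M : Matrix (Fin N) (Fin N) ℝ :=
    fun i j => R i * A (N - i) j * Real.exp (coeffExponent N B j) with hM
  have hlo : ∀ i j : Fin N, 1 / 2 * Real.exp (-(B * ((i : ℝ) - j) ^ 2)) ≤ M i j := by
    intro i j
    rw [← hexp, hM]
    calc _ = R i * (1 / 2 * Real.exp (-(2 * ((N - (i : ℕ) : ℕ) : ℝ) * (B * ((j : ℝ) + 1)))))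
          * Real.exp (coeffExponent N B j) := by ring
      _ ≤ _ := mul_le_mul_of_nonneg_right (mul_le_mul_of_nonneg_left (hA _ (hk i) j).1
          (hRpos i).le) (Real.exp_pos _).le
  have hhi : ∀ i j : Fin N, M i j ≤ 2 * Real.exp (-(B * ((i : ℝ) - j) ^ 2)) := by
    intro i j
    rw [← hexp, hM]
    calc _ ≤ R i * (2 * Real.exp (-(2 * ((N - (i : ℕ) : ℕ) : ℝ) * (B * ((j : ℝ) + 1)))))
          * Real.exp (coeffExponent N B j) := mul_le_mul_of_nonneg_right
            (mul_le_mul_of_nonneg_left (hA _ (hk i) j).2 (hRpos i).le) (Real.exp_pos _).le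
      _ = _ := by ring
  have hdiag : ∀ i, 1 / 2 ≤ M i i := by
    intro i
    simpa using hlo i i
  have hoff : ∀ i, ∑ j ∈ Finset.univ.erase i, |M i j| ≤ 1 / 4 := by
    intro i
    have hb : ∀ j ∈ Finset.univ.erase i, |M i j| ≤ 2 * Real.exp (-B) := by
      intro j hj
      have hne : (i : ℕ) ≠ j := fun h => Finset.ne_of_mem_erase hj (Fin.ext h.symm)
      have h1 : (1 : ℝ) ≤ ((i : ℝ) - j) ^ 2 := by
        have h2 : (1 : ℤ) ≤ |((i : ℕ) : ℤ) - (j : ℕ)| :=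
          Int.one_le_abs (sub_ne_zero.2 (by exact_mod_cast hne))
        have h3 : (1 : ℝ) ≤ |((i : ℕ) : ℝ) - (j : ℕ)| := by exact_mod_cast h2
        rw [← sq_abs]
        nlinarith
      rw [abs_of_nonneg (le_trans (by positivity) (hlo i j))]
      refine (hhi i j).trans ?_
      have : Real.exp (-(B * ((i : ℝ) - j) ^ 2)) ≤ Real.exp (-B) :=
        Real.exp_le_exp.2 (by nlinarith)
      linarith
    refine (Finset.sum_le_sum hb).trans ?_
    rw [Finset.sum_const, nsmul_eq_mul]
    have : ((Finset.univ.erase i).card : ℝ) ≤ N := by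
      exact_mod_cast (Finset.card_le_univ _).trans_eq (Fintype.card_fin N)
    nlinarith [Real.exp_pos (-B)]
  have hv : ∀ i : Fin N, |R i * r (N - i)| ≤ ρ := by
    intro i
    rw [abs_mul, abs_of_pos (hRpos i)]
    have : R i ≤ 1 := Real.exp_le_one_iff.2 (neg_nonpos.2 (by positivity))
    calc _ ≤ 1 * ρ := mul_le_mul this (hr _ (hk i)) (abs_nonneg _) zero_le_one
      _ = ρ := one_mul ρ
  obtain ⟨x, hx, hxb⟩ := exists_mulVec_eq hdiag hoff hv
  refine ⟨fun j => x j * Real.exp (coeffExponent N B j), fun k hk' => ?_, fun j => ?_⟩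
  · obtain ⟨h1, h2⟩ := Finset.mem_Icc.1 hk'
    have := congrFun hx ⟨N - k, by omega⟩
    have hkk : N - (N - k) = k := by omega
    simp only [Matrix.mulVec, dotProduct, hM, hkk] at this
    refine mul_left_cancel₀ (hRpos ⟨N - k, by omega⟩).ne' ?_
    rw [← this, Finset.mul_sum]
    refine Finset.sum_congr rfl fun j _ => by ring
  · rw [abs_mul, abs_of_pos (Real.exp_pos _)]
    exact mul_le_mul_of_nonneg_right (hxb j) (Real.exp_pos _).le

/-! ### Integrals against the derivative of the profile -/

section combination
variable {N : ℕ} {h : ℝ} {φ₀ : ℝ → ℝ} {φ : Fin N → ℝ → ℝ} {c : Fin N → ℝ}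

lemma norm_integral_combination_le {a₀ b₀ : ℝ} {a b C : Fin N → ℝ} {C₀ : ℝ}
    (hφ₀ : IsUnitBump a₀ b₀ φ₀) (hφ : ∀ j, IsUnitBump (a j) (b j) (φ j)) (h0 : 0 ≤ h)
    (hb₀ : b₀ ≤ h) (hb : ∀ j, b j ≤ h) {K : ℝ → ℂ} (hKc : ContinuousOn K (Icc 0 h))
    (hK₀ : ∀ y ∈ Icc a₀ b₀, ‖K y‖ ≤ C₀ * (y / 2))
    (hK : ∀ j, ∀ y ∈ Icc (a j) (b j), ‖K y‖ ≤ C j * (y / 2)) :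
    ‖∫ y in (0:ℝ)..h, ((φ₀ y + ∑ j, c j * φ j y : ℝ) : ℂ) * K y‖ ≤ C₀ + ∑ j, |c j| * C j := by
  have i0 : IntervalIntegrable (fun y => (φ₀ y : ℂ) * K y) MeasureTheory.volume 0 h :=
    ((Complex.continuous_ofReal.comp hφ₀.smooth.continuous).continuousOn.mul
      hKc).intervalIntegrable_of_Icc h0
  have i1 : ∀ j ∈ Finset.univ, IntervalIntegrable (fun y => (c j : ℂ) * ((φ j y : ℂ) * K y))
      MeasureTheory.volume 0 h := fun j _ =>
    (((Complex.continuous_ofReal.comp (hφ j).smooth.continuous).continuousOn.mul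
      hKc).intervalIntegrable_of_Icc h0).const_mul _
  have e : ∫ y in (0:ℝ)..h, ((φ₀ y + ∑ j, c j * φ j y : ℝ) : ℂ) * K y
      = (∫ y in (0:ℝ)..h, (φ₀ y : ℂ) * K y)
        + ∑ j, (c j : ℂ) * ∫ y in (0:ℝ)..h, (φ j y : ℂ) * K y := by
    simp only [← intervalIntegral.integral_const_mul]
    rw [← intervalIntegral.integral_finsetSum i1, ← intervalIntegral.integral_add i0]
    · refine intervalIntegral.integral_congr fun y _ => ?_
      push_cast
      rw [add_mul, Finset.sum_mul]
      simp only [mul_assoc]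
    · simpa only [Finset.sum_fn] using IntervalIntegrable.sum Finset.univ i1
  rw [e]
  refine (norm_add_le _ _).trans (add_le_add (hφ₀.norm_integral_le h0 hb₀ hK₀) ?_)
  refine (norm_sum_le _ _).trans (Finset.sum_le_sum fun j _ => ?_)
  rw [norm_mul, Complex.norm_real, Real.norm_eq_abs]
  exact mul_le_mul_of_nonneg_left ((hφ j).norm_integral_le h0 (hb j) (hK j)) (abs_nonneg _)

lemma integral_combination (hφ₀ : Continuous φ₀) (hφ : ∀ j, Continuous (φ j)) (h0 : 0 ≤ h)
    {K : ℝ → ℝ} (hKc : ContinuousOn K (Icc 0 h)) :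
    ∫ y in (0:ℝ)..h, (φ₀ y + ∑ j, c j * φ j y) * K y
      = (∫ y in (0:ℝ)..h, φ₀ y * K y) + ∑ j, c j * ∫ y in (0:ℝ)..h, φ j y * K y := by
  have i0 : IntervalIntegrable (fun y => φ₀ y * K y) MeasureTheory.volume 0 h :=
    (hφ₀.continuousOn.mul hKc).intervalIntegrable_of_Icc h0
  have i1 : ∀ j ∈ Finset.univ, IntervalIntegrable (fun y => c j * (φ j y * K y))
      MeasureTheory.volume 0 h := fun j _ =>
    (((hφ j).continuousOn.mul hKc).intervalIntegrable_of_Icc h0).const_mul _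
  simp only [← intervalIntegral.integral_const_mul]
  rw [← intervalIntegral.integral_finsetSum i1, ← intervalIntegral.integral_add i0]
  · refine intervalIntegral.integral_congr fun y _ => ?_
    rw [add_mul, Finset.sum_mul]
    simp only [mul_assoc]
  · simpa only [Finset.sum_fn] using IntervalIntegrable.sum Finset.univ i1

end combination

lemma continuous_realCharKer (h k : ℝ) : Continuous fun y => realCharKer h y k := by
  unfold realCharKer
  fun_prop

lemma charFun_self {h k : ℝ} (f : ℝ → ℝ) (hh : 0 < h) (hk : 0 < k) :
    charFun h k f ((k : ℂ) ^ 2) k = ((∫ y in (0:ℝ)..h, f y * realCharKer h y k : ℝ) : ℂ) := by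
  rw [charFun, ← intervalIntegral.integral_ofReal]
  refine intervalIntegral.integral_congr fun y _ => ?_
  simp only [charKer_self y hh hk, Complex.ofReal_mul]

lemma isProfile_integral {h a : ℝ} {f : ℝ → ℝ} (ha : 0 < a) (hah : a < h) (hf : ContDiff ℝ ∞ f)
    (hz : ∀ y < a, f y = 0) : IsProfile h (fun y => ∫ z in (0:ℝ)..y, f z) := by
  have hd : ∀ y, HasDerivAt (fun y => ∫ z in (0:ℝ)..y, f z) (f y) y := fun y =>
    hf.continuous.integral_hasStrictDerivAt 0 y |>.hasDerivAt
  have hh : 0 < h := ha.trans hah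
  refine ⟨ContDiff.contDiffOn ?_, a, ⟨ha, hah⟩, fun y hy => ⟨?_, ?_⟩⟩
  · rw [contDiff_infty_iff_deriv]
    refine ⟨fun y => (hd y).differentiableAt, ?_⟩
    rwa [show deriv (fun y => ∫ z in (0:ℝ)..y, f z) = f from funext fun y => (hd y).deriv]
  · rw [intervalIntegral.integral_of_le hy.1]
    exact MeasureTheory.setIntegral_eq_zero_of_forall_eq_zero fun z hz' =>
      hz z (hz'.2.trans_lt hy.2)
  · rw [derivWithin_profile hh hd ⟨hy.1, (hy.2.trans hah).le⟩]
    exact hz y hy.2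

/-- The size of the coefficients, relative to the small parameter. -/
noncomputable def coeffBound (N : ℕ) (B : ℝ) : ℝ :=
  ∑ j : Fin N, 12 * N * Real.exp (coeffExponent N B j)

lemma coeffBound_nonneg (N : ℕ) (B : ℝ) : 0 ≤ coeffBound N B :=
  Finset.sum_nonneg fun _ _ => by positivity

/-! ### Estimates for the designed profile -/

/-- The parameters and bump functions from which the profile is built. -/
structure IsDesign (N : ℕ) (B Y ε δ h : ℝ) (φ₀ : ℝ → ℝ) (φ : Fin N → ℝ → ℝ) : Prop where
  one_le : 1 ≤ N
  B_one_le : 1 ≤ B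
  B_large : 48 * (N : ℝ) ^ 2 * Real.exp (-B) ≤ 1
  Y_eq : Y = B * N + 1
  ε_pos : 0 < ε
  ε_small : 72 * N * (1 + Y * coeffBound N B) * ε ≤ 1
  δ_le : δ ≤ ε / 4
  const_le : (1 + 2 * δ) * (1 + δ) * (1 + 2 * δ) * Real.exp (2 * δ * Y) ≤ 1 + ε / 4
  tall : IsTall (ε / 2) Y δ h
  bump₀ : IsUnitBump (ε / 2) ε φ₀
  bump : ∀ j : Fin N, IsUnitBump (B * ((j : ℝ) + 1)) (B * ((j : ℝ) + 1) + 1 / (8 * N)) (φ j)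

/-- The derivative of the profile. -/
noncomputable def combination {N : ℕ} (φ₀ : ℝ → ℝ) (φ : Fin N → ℝ → ℝ) (c : Fin N → ℝ) (y : ℝ) : ℝ :=
  φ₀ y + ∑ j, c j * φ j y

namespace IsDesign
variable {N : ℕ} {B Y ε δ h : ℝ} {φ₀ : ℝ → ℝ} {φ : Fin N → ℝ → ℝ} {c : Fin N → ℝ}

lemma N_pos (D : IsDesign N B Y ε δ h φ₀ φ) : (1 : ℝ) ≤ N := by exact_mod_cast D.one_le

lemma Y_pos (D : IsDesign N B Y ε δ h φ₀ φ) : 1 ≤ Y := by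
  rw [D.Y_eq]
  nlinarith [D.B_one_le, D.N_pos]

lemma ε_mul_le (D : IsDesign N B Y ε δ h φ₀ φ) :
    72 * N * ε ≤ 1 ∧ 72 * N * (Y * (coeffBound N B * ε)) ≤ 1 := by
  have h1 := D.N_pos
  have h2 := D.Y_pos
  have h3 := D.ε_pos
  have h4 := coeffBound_nonneg N B
  have h5 := D.ε_small
  have h6 : 0 ≤ 72 * N * ε := by positivity
  have h7 : 0 ≤ 72 * N * (Y * (coeffBound N B * ε)) := by positivity
  constructor <;> linarith

lemma ε_le (D : IsDesign N B Y ε δ h φ₀ φ) : ε ≤ 1 / 72 := by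
  have := D.ε_mul_le.1
  nlinarith [D.N_pos, D.ε_pos]

lemma coeffBound_mul_le (D : IsDesign N B Y ε δ h φ₀ φ) : coeffBound N B * ε ≤ 1 / 72 := by
  have h1 := D.ε_mul_le.2
  have h4 : 0 ≤ coeffBound N B * ε := mul_nonneg (coeffBound_nonneg N B) D.ε_pos.le
  have h5 := mul_le_mul_of_nonneg_right D.Y_pos h4
  have h6 := mul_le_mul_of_nonneg_right D.N_pos (h4.trans (by linarith : _ ≤ Y * (coeffBound N B * ε)))
  linarith

lemma δ_pos (D : IsDesign N B Y ε δ h φ₀ φ) : 0 < δ := D.tall.η_pos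

lemma support₀_subset (D : IsDesign N B Y ε δ h φ₀ φ) : Icc (ε / 2) ε ⊆ Icc (ε / 2) Y :=
  Icc_subset_Icc_right (by linarith [D.ε_le, D.Y_pos])

lemma B_le_support (D : IsDesign N B Y ε δ h φ₀ φ) (j : Fin N) : 1 ≤ B * ((j : ℝ) + 1) := by
  have : (0 : ℝ) ≤ j := by positivity
  nlinarith [D.B_one_le]

lemma support_le (D : IsDesign N B Y ε δ h φ₀ φ) (j : Fin N) :
    B * ((j : ℝ) + 1) + 1 / (8 * N) ≤ Y := by
  have h1 : ((j : ℝ) + 1) ≤ N := by exact_mod_cast j.2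
  have h2 : 1 / (8 * (N : ℝ)) ≤ 1 := by
    rw [div_le_one (by linarith [D.N_pos])]
    linarith [D.N_pos]
  rw [D.Y_eq]
  nlinarith [D.B_one_le]

lemma support_subset (D : IsDesign N B Y ε δ h φ₀ φ) (j : Fin N) :
    Icc (B * ((j : ℝ) + 1)) (B * ((j : ℝ) + 1) + 1 / (8 * N)) ⊆ Icc (ε / 2) Y :=
  Icc_subset_Icc (by linarith [D.ε_le, D.B_le_support j]) (D.support_le j)

lemma contDiff_combination (D : IsDesign N B Y ε δ h φ₀ φ) : ContDiff ℝ ∞ (combination φ₀ φ c) :=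
  D.bump₀.smooth.add (ContDiff.sum fun j _ => contDiff_const.mul (D.bump j).smooth)

lemma combination_eq_zero (D : IsDesign N B Y ε δ h φ₀ φ) {y : ℝ} (hy : y < ε / 2) :
    combination φ₀ φ c y = 0 := by
  rw [combination, D.bump₀.eq_zero y fun h' => absurd h'.1 (not_le.2 hy), zero_add]
  refine Finset.sum_eq_zero fun j _ => ?_
  rw [(D.bump j).eq_zero y fun h' => absurd (D.support_subset j h').1 (not_le.2 hy), mul_zero]

lemma norm_charKer_le (D : IsDesign N B Y ε δ h φ₀ φ) {y k : ℝ} (hy : y ∈ Icc (ε / 2) Y)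
    (hk : 1 ≤ k) {E s : ℂ} (hE : (k - δ) ^ 2 ≤ E.re) (hs : k - δ ≤ s.re) :
    ‖charKer h y k E s‖ ≤ (1 + ε / 4) * Real.exp (-(2 * k * y)) * (y / 2) := by
  have hy0 : 0 < y := by linarith [hy.1, D.ε_pos]
  have := D.tall.norm_charKer_le hy hk D.δ_pos.le (by linarith [D.δ_le, D.ε_le]) hE hs
  refine this.trans ?_
  calc _ ≤ (1 + ε / 4) * (y / 2 * Real.exp (-(2 * k * y))) :=
        mul_le_mul_of_nonneg_right D.const_le (by positivity)
    _ = _ := by ring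

lemma realCharKer_le (D : IsDesign N B Y ε δ h φ₀ φ) {y k : ℝ} (hy : y ∈ Icc (ε / 2) Y)
    (hk : 1 ≤ k) :
    realCharKer h y k ≤ (1 + ε / 4) * Real.exp (-(2 * k * y)) * (y / 2) := by
  have := D.norm_charKer_le hy hk (E := (k : ℂ) ^ 2) (s := k)
    (by rw [← Complex.ofReal_pow, Complex.ofReal_re]
        nlinarith [D.δ_pos, D.δ_le, D.ε_le]) (by simpa using D.δ_pos.le)
  rw [charKer_self y D.tall.pos (by linarith), Complex.norm_real] at this
  exact (le_abs_self _).trans this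

lemma le_realCharKer (D : IsDesign N B Y ε δ h φ₀ φ) {y k : ℝ} (hy : y ∈ Icc (ε / 2) Y)
    (hk : 1 ≤ k) :
    (1 - ε / 4) * Real.exp (-(2 * k * y)) * (y / 2) ≤ realCharKer h y k := by
  have hy0 : 0 < y := by linarith [hy.1, D.ε_pos]
  refine le_trans ?_ (D.tall.le_realCharKer hy hk)
  calc _ = (1 - ε / 4) * (y / 2 * Real.exp (-(2 * k * y))) := by ring
    _ ≤ _ := mul_le_mul_of_nonneg_right (by linarith [D.δ_le]) (by positivity)

/-- The main bump alone gives 1 + O(Nε) for k ≤ N, so the right-hand side of the linear system is at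
most 3Nε, and the coefficients inherit the factor ε. -/
lemma exists_charFun_eq_one (D : IsDesign N B Y ε δ h φ₀ φ) :
    ∃ c : Fin N → ℝ, (∀ j, |c j| ≤ 12 * N * ε * Real.exp (coeffExponent N B j)) ∧
      ∀ k : ℕ, k ∈ Finset.Icc 1 N → charFun h k (combination φ₀ φ c) ((k : ℂ) ^ 2) k = 1 := by
  have hN := D.N_pos
  have hε := D.ε_pos
  have hε1 := D.ε_le
  have hh := D.tall.pos
  have hYh := D.tall.lt
  have hY := D.Y_pos
  have hcont : ∀ k : ℝ, ContinuousOn (fun y => realCharKer h y k) (Icc 0 h) := fun k =>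
    (continuous_realCharKer h k).continuousOn
  have hA : ∀ k ∈ Finset.Icc 1 N, ∀ j : Fin N,
      1 / 2 * Real.exp (-(2 * k * (B * ((j : ℝ) + 1))))
        ≤ (∫ y in (0:ℝ)..h, φ j y * realCharKer h y k) ∧
      (∫ y in (0:ℝ)..h, φ j y * realCharKer h y k)
        ≤ 2 * Real.exp (-(2 * k * (B * ((j : ℝ) + 1)))) := by
    intro k hk j
    obtain ⟨h1, h2⟩ := Finset.mem_Icc.1 hk
    have hk1 : (1 : ℝ) ≤ k := by exact_mod_cast h1
    have hk2 : (k : ℝ) ≤ N := by exact_mod_cast h2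
    constructor
    · refine (D.bump j).le_integral hh.le ((D.support_le j).trans hYh.le) (hcont k) fun y hy => ?_
      have hy' := D.support_subset j hy
      have hy0 : 0 < y := by linarith [hy'.1]
      refine le_trans (mul_le_mul_of_nonneg_right ?_ (by positivity)) (D.le_realCharKer hy' hk1)
      -- The bump width 1/(8N) keeps k times the offset below 1/8, so at most a factor exp(-1/4) ≥
      -- 3/4 is lost for all k ≤ N.
      have e1 : Real.exp (-(2 * k * (B * ((j : ℝ) + 1)))) * Real.exp (-(1 / 4))
          ≤ Real.exp (-(2 * k * y)) := by
        rw [← Real.exp_add]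
        refine Real.exp_le_exp.2 ?_
        have h3 : y - B * ((j : ℝ) + 1) ≤ 1 / (8 * N) := by linarith [hy.2]
        have h4 : (k : ℝ) * (y - B * ((j : ℝ) + 1)) ≤ 1 / 8 := by
          calc _ ≤ (N : ℝ) * (1 / (8 * N)) :=
                mul_le_mul hk2 h3 (by linarith [hy.1]) (by linarith)
            _ = 1 / 8 := by field_simp
        linarith
      have e2 := Real.add_one_le_exp (-(1 / 4) : ℝ)
      have e3 := Real.exp_pos (-(2 * k * (B * ((j : ℝ) + 1))))
      have e4 := Real.exp_pos (-(2 * k * y))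
      nlinarith
    · refine (D.bump j).integral_le hh.le ((D.support_le j).trans hYh.le) (hcont k) fun y hy => ?_
      have hy' := D.support_subset j hy
      have hy0 : 0 < y := by linarith [hy'.1]
      refine (D.realCharKer_le hy' hk1).trans (mul_le_mul_of_nonneg_right ?_ (by positivity))
      have e1 : Real.exp (-(2 * k * y)) ≤ Real.exp (-(2 * k * (B * ((j : ℝ) + 1)))) :=
        Real.exp_le_exp.2 (by nlinarith [hy.1])
      nlinarith [Real.exp_pos (-(2 * k * y))]
  have hr : ∀ k ∈ Finset.Icc 1 N,
      |1 - ∫ y in (0:ℝ)..h, φ₀ y * realCharKer h y k| ≤ 3 * N * ε := by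
    intro k hk
    obtain ⟨h1, h2⟩ := Finset.mem_Icc.1 hk
    have hk1 : (1 : ℝ) ≤ k := by exact_mod_cast h1
    have hk2 : (k : ℝ) ≤ N := by exact_mod_cast h2
    have u1 : (∫ y in (0:ℝ)..h, φ₀ y * realCharKer h y k) ≤ 1 + ε / 4 := by
      refine D.bump₀.integral_le hh.le (by linarith) (hcont k) fun y hy => ?_
      have hy' := D.support₀_subset hy
      have hy0 : 0 < y := by linarith [hy'.1]
      refine (D.realCharKer_le hy' hk1).trans (mul_le_mul_of_nonneg_right ?_ (by positivity))
      have : Real.exp (-(2 * k * y)) ≤ 1 := Real.exp_le_one_iff.2 (neg_nonpos.2 (by positivity))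
      nlinarith
    have u2 : (1 - ε / 4) * (1 - 2 * N * ε) ≤ ∫ y in (0:ℝ)..h, φ₀ y * realCharKer h y k := by
      refine D.bump₀.le_integral hh.le (by linarith) (hcont k) fun y hy => ?_
      have hy' := D.support₀_subset hy
      have hy0 : 0 < y := by linarith [hy'.1]
      refine le_trans (mul_le_mul_of_nonneg_right ?_ (by positivity)) (D.le_realCharKer hy' hk1)
      have e1 := Real.add_one_le_exp (-(2 * k * y))
      have e2 : (k : ℝ) * y ≤ N * ε := mul_le_mul hk2 hy.2 hy0.le (by linarith)
      exact mul_le_mul_of_nonneg_left (by linarith) (by linarith)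
    rw [abs_le]
    constructor <;> nlinarith
  have hBN : 8 * N * Real.exp (-B) ≤ 1 := by
    have := D.B_large
    have h1 : (N : ℝ) * Real.exp (-B) ≤ (N : ℝ) ^ 2 * Real.exp (-B) :=
      mul_le_mul_of_nonneg_right (by nlinarith) (Real.exp_pos _).le
    have h2 : 0 ≤ (N : ℝ) * Real.exp (-B) := by positivity
    linarith
  obtain ⟨c, hc, hcb⟩ := exists_coeff (B := B) (by linarith [D.B_one_le]) hBN hA hr
  refine ⟨c, fun j => (hcb j).trans_eq (by ring), fun k hk => ?_⟩
  have hk0 : (0 : ℝ) < k := by exact_mod_cast (Finset.mem_Icc.1 hk).1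
  have e := charFun_self (combination φ₀ φ c) hh hk0
  rw [Complex.ofReal_natCast] at e
  rw [e]
  unfold combination
  rw [integral_combination D.bump₀.smooth.continuous (fun j => (D.bump j).smooth.continuous) hh.le
    (hcont k), hc k hk]
  norm_num

lemma sum_coeff_le (hc : ∀ j, |c j| ≤ 12 * N * ε * Real.exp (coeffExponent N B j)) :
    ∑ j, |c j| ≤ coeffBound N B * ε := by
  rw [coeffBound, Finset.sum_mul]
  exact Finset.sum_le_sum fun j _ => (hc j).trans_eq (by ring)

lemma norm_charFun_le (D : IsDesign N B Y ε δ h φ₀ φ) {k : ℝ} (hk : 1 ≤ k) {E s : ℂ}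
    (hE : (k - δ) ^ 2 ≤ E.re) (hs : k - δ ≤ s.re) :
    ‖charFun h k (combination φ₀ φ c) E s‖ ≤ (1 + ε / 4) *
      (Real.exp (-(k * ε)) + ∑ j, |c j| * Real.exp (-(2 * k * (B * ((j : ℝ) + 1))))) := by
  have hε := D.ε_pos
  have hYh := D.tall.lt
  have key := norm_integral_combination_le (c := c) D.bump₀ D.bump D.tall.pos.le
    (by linarith [D.ε_le, D.Y_pos]) (fun j => (D.support_le j).trans hYh.le)
    (continuousOn_charKer D.tall.pos (zero_lt_one.trans_le hk) E s)
    (C₀ := (1 + ε / 4) * Real.exp (-(k * ε)))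
    (C := fun j => (1 + ε / 4) * Real.exp (-(2 * k * (B * ((j : ℝ) + 1)))))
    (fun y hy => ?_) (fun j y hy => ?_)
  · refine key.trans_eq ?_
    rw [mul_add, Finset.mul_sum]
    congr 1
    exact Finset.sum_congr rfl fun j _ => by ring
  · have hy0 : 0 < y := by linarith [hy.1]
    refine (D.norm_charKer_le (D.support₀_subset hy) hk hE hs).trans ?_
    have : Real.exp (-(2 * k * y)) ≤ Real.exp (-(k * ε)) :=
      Real.exp_le_exp.2 (by nlinarith [hy.1])
    gcongr
  · have hy' := D.support_subset j hy
    have hy0 : 0 < y := by linarith [hy'.1]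
    refine (D.norm_charKer_le hy' hk hE hs).trans ?_
    have : Real.exp (-(2 * k * y)) ≤ Real.exp (-(2 * k * (B * ((j : ℝ) + 1)))) :=
      Real.exp_le_exp.2 (by nlinarith [hy.1])
    gcongr

/-- A crude a priori bound: with the characteristic equation it gives |s| ≤ 2k, which bounds λ
independently of ν. -/
lemma norm_charFun_le_two (D : IsDesign N B Y ε δ h φ₀ φ)
    (hc : ∀ j, |c j| ≤ 12 * N * ε * Real.exp (coeffExponent N B j)) {k : ℝ} (hk : 1 ≤ k) {E s : ℂ}
    (hE : (k - δ) ^ 2 ≤ E.re) (hs : k - δ ≤ s.re) :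
    ‖charFun h k (combination φ₀ φ c) E s‖ ≤ 2 := by
  have hε := D.ε_pos
  refine (D.norm_charFun_le hk hE hs).trans ?_
  have e1 : Real.exp (-(k * ε)) ≤ 1 := Real.exp_le_one_iff.2 (neg_nonpos.2 (by positivity))
  have e2 : ∑ j, |c j| * Real.exp (-(2 * k * (B * ((j : ℝ) + 1)))) ≤ coeffBound N B * ε := by
    refine le_trans (Finset.sum_le_sum fun j _ => ?_) (sum_coeff_le hc)
    refine mul_le_of_le_one_right (abs_nonneg _) (Real.exp_le_one_iff.2 (neg_nonpos.2 ?_))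
    have := D.B_le_support j
    positivity
  have e3 := D.coeffBound_mul_le
  have e4 := D.ε_le
  calc _ ≤ (1 + ε / 4) * (1 + 1 / 72) :=
        mul_le_mul_of_nonneg_left (by linarith) (by linarith)
    _ ≤ 2 := by linarith

/-- Since k ≥ N + 1 ≥ 2, the main bump contributes at most exp(-2ε) ≤ 1 - ε before the kernel error.
Against exp(-2kB(j + 1)) the growth of each coefficient is beaten, leaving exp(-B(j + 1)²) ≤
exp(-B); N such terms sum to at most ε/4. -/
lemma norm_charFun_lt_one (D : IsDesign N B Y ε δ h φ₀ φ)
    (hc : ∀ j, |c j| ≤ 12 * N * ε * Real.exp (coeffExponent N B j)) {k : ℝ} (hk : (N : ℝ) + 1 ≤ k)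
    {E s : ℂ} (hE : (k - δ) ^ 2 ≤ E.re) (hs : k - δ ≤ s.re) :
    ‖charFun h k (combination φ₀ φ c) E s‖ ≤ 1 - ε / 2 := by
  have hε := D.ε_pos
  have hε1 := D.ε_le
  have hN := D.N_pos
  have hB := D.B_one_le
  refine (D.norm_charFun_le (by linarith) hE hs).trans ?_
  have e1 : Real.exp (-(k * ε)) ≤ 1 - ε := by
    have h1 : Real.exp (-(k * ε)) ≤ Real.exp (-(2 * ε)) := Real.exp_le_exp.2 (by nlinarith)
    refine h1.trans ?_
    rw [Real.exp_neg, inv_le_comm₀ (Real.exp_pos _) (by linarith), inv_le_iff_one_le_mul₀ (by linarith)]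
    have := Real.add_one_le_exp (2 * ε)
    nlinarith
  have e2 : ∑ j, |c j| * Real.exp (-(2 * k * (B * ((j : ℝ) + 1)))) ≤ ε / 4 := by
    have h1 : ∀ j ∈ (Finset.univ : Finset (Fin N)),
        |c j| * Real.exp (-(2 * k * (B * ((j : ℝ) + 1)))) ≤ 12 * N * ε * Real.exp (-B) := by
      intro j _
      refine (mul_le_mul_of_nonneg_right (hc j) (Real.exp_pos _).le).trans ?_
      rw [mul_assoc, ← Real.exp_add]
      refine mul_le_mul_of_nonneg_left (Real.exp_le_exp.2 ?_) (by positivity)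
      rw [coeffExponent]
      have hj : (0 : ℝ) ≤ j := by positivity
      have h2 : 0 ≤ (k - (N + 1)) * (B * ((j : ℝ) + 1)) :=
        mul_nonneg (by linarith) (by positivity)
      have h3 : 0 ≤ B * (((j : ℝ) + 1) ^ 2 - 1) := mul_nonneg (by linarith) (by nlinarith)
      nlinarith
    refine (Finset.sum_le_sum h1).trans ?_
    rw [Finset.sum_const, nsmul_eq_mul, Finset.card_univ, Fintype.card_fin]
    nlinarith [D.B_large]
  calc _ ≤ (1 + ε / 4) * (1 - ε + ε / 4) :=
        mul_le_mul_of_nonneg_left (by linarith) (by linarith)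
    _ ≤ 1 - ε / 2 := by nlinarith

/-- The constant must beat 1/k for every k ≤ N. The dependence on s costs 1/(4N), by the smallness
of ε; the dependence on E costs 1/(8N), up to the factor 1 + 1/72 for the total mass of the bumps.
-/
lemma norm_charFun_sub_le (D : IsDesign N B Y ε δ h φ₀ φ)
    (hc : ∀ j, |c j| ≤ 12 * N * ε * Real.exp (coeffExponent N B j)) {k ν : ℝ} (hk : 1 ≤ k)
    (hkN : k ≤ N) (hν : 1152 * (N : ℝ) ^ 3 ≤ ν) {E s : ℂ} (hs : 1 / 2 ≤ s.re)
    (hE : ‖E - (k : ℂ) ^ 2‖ < 1 / 2) (hEs : ‖E - (k : ℂ) ^ 2‖ * ν ≤ 3 * k * ‖s - k‖) :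
    ‖charFun h k (combination φ₀ φ c) E s - charFun h k (combination φ₀ φ c) ((k : ℂ) ^ 2) k‖
      ≤ ‖s - k‖ / (2 * N) := by
  have hε := D.ε_pos
  have hN := D.N_pos
  have hY := D.Y_pos
  have hYh := D.tall.lt
  have hh := D.tall.pos
  have hk0 : 0 < k := by linarith
  have hν0 : 0 < ν := lt_of_lt_of_le (by positivity) hν
  set t := ‖s - k‖ with ht
  have ht0 : 0 ≤ t := norm_nonneg _
  -- Here 1152 = 48 · 3 · 8, and the cube of N comes from k² ≤ N² and the target 1/(8N).
  have hlip : 48 * k * ‖E - (k : ℂ) ^ 2‖ ≤ t / (8 * N) := by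
    rw [le_div_iff₀ (by positivity)]
    have h1 : k * k ≤ N * N := mul_le_mul hkN hkN hk0.le (by linarith)
    have h2 : ‖E - (k : ℂ) ^ 2‖ ≤ 3 * k * t / ν := (le_div_iff₀ hν0).2 hEs
    calc 48 * k * ‖E - (k : ℂ) ^ 2‖ * (8 * N) ≤ 48 * k * (3 * k * t / ν) * (8 * N) := by gcongr
      _ = 1152 * ((k * k) * N * t) / ν := by ring
      _ ≤ 1152 * ((N * N) * N * t) / ν := by gcongr
      _ ≤ t := by
        rw [div_le_iff₀ hν0]
        nlinarith [mul_le_mul_of_nonneg_left hν ht0]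
  have hcf : ContinuousOn (fun y => (combination φ₀ φ c y : ℂ)) (Icc 0 h) :=
    (Complex.continuous_ofReal.comp D.contDiff_combination.continuous).continuousOn
  have c1 := continuousOn_charKer hh hk0 E s
  have c2 := continuousOn_charKer hh hk0 ((k : ℂ) ^ 2) k
  have hsub := intervalIntegral.integral_sub (μ := MeasureTheory.volume)
    ((hcf.mul c1).intervalIntegrable_of_Icc hh.le) ((hcf.mul c2).intervalIntegrable_of_Icc hh.le)
  simp only [Pi.mul_apply, ← mul_sub] at hsub
  rw [charFun, charFun, ← hsub]
  have key := norm_integral_combination_le (c := c) D.bump₀ D.bump hh.le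
    (by linarith [D.ε_le]) (fun j => (D.support_le j).trans hYh.le) (c1.sub c2)
    (C₀ := 18 * ε * t + t / (8 * N)) (C := fun _ => 18 * Y * t + t / (8 * N))
    (fun y hy => ?_) (fun j y hy => ?_)
  · refine key.trans ?_
    rw [← Finset.sum_mul]
    have hb : 0 ≤ t / (8 * N) := by positivity
    have h1 := sum_coeff_le hc
    have h2 : (∑ j, |c j|) * (18 * Y * t + t / (8 * N))
        ≤ coeffBound N B * ε * (18 * Y * t) + 1 / 72 * (t / (8 * N)) := by
      rw [mul_add]
      exact add_le_add (mul_le_mul_of_nonneg_right h1 (by positivity))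
        (mul_le_mul_of_nonneg_right (h1.trans D.coeffBound_mul_le) hb)
    have h3 : 18 * ε * t + coeffBound N B * ε * (18 * Y * t) ≤ t / (8 * N) * 2 := by
      rw [div_mul_eq_mul_div, le_div_iff₀ (by positivity)]
      linarith [mul_le_mul_of_nonneg_right D.ε_small ht0]
    have h4 : t / (2 * N) = t / (8 * N) * 4 := by field_simp; ring
    rw [h4]
    linarith
  · have hy' := D.support₀_subset hy
    refine (D.tall.norm_charKer_sub_le hy' hk hE hs).trans ?_
    have hy0 : 0 < y := by linarith [hy.1]
    rw [mul_comm]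
    gcongr
    exact hy.2
  · have hy' := D.support_subset j hy
    refine (D.tall.norm_charKer_sub_le hy' hk hE hs).trans ?_
    have hy0 : 0 < y := by linarith [hy'.1]
    rw [mul_comm]
    gcongr
    exact hy'.2

end IsDesign
-- Location of the eigenvalues
namespace IsDesign
variable {N : ℕ} {B Y ε δ h : ℝ} {φ₀ : ℝ → ℝ} {φ : Fin N → ℝ → ℝ} {c : Fin N → ℝ}

lemma hasDerivAt_integral (D : IsDesign N B Y ε δ h φ₀ φ) (y : ℝ) :
    HasDerivAt (fun y => ∫ z in (0:ℝ)..y, combination φ₀ φ c z) (combination φ₀ φ c y) y :=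
  (D.contDiff_combination.continuous.integral_hasStrictDerivAt 0 y).hasDerivAt

/-- The characteristic equation at an eigenvalue to the right of the spectral gap. -/
lemma charFun_eq (D : IsDesign N B Y ε δ h φ₀ φ) {ν : ℝ} (hν : 1 ≤ ν) {k : ℕ} (hk : 1 ≤ k)
    {lam : ℂ} (hlam : -δ ≤ lam.re)
    (hev : IsEigenvalue ν h (fun y => ∫ z in (0:ℝ)..y, combination φ₀ φ c z) k lam) :
    ((k : ℝ) - δ) ^ 2 ≤ ((k : ℂ) ^ 2 + lam / ν).re ∧
      (k : ℝ) - δ ≤ (csqrt ((k : ℂ) ^ 2 + lam)).re ∧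
      charFun h k (combination φ₀ φ c) ((k : ℂ) ^ 2 + lam / ν) (csqrt ((k : ℂ) ^ 2 + lam))
        = csqrt ((k : ℂ) ^ 2 + lam) / k := by
  have hk1 : (1 : ℝ) ≤ k := by exact_mod_cast hk
  have hδ := D.δ_pos
  have hδ1 : δ ≤ 1 / 2 := by linarith [D.δ_le, D.ε_le]
  have hkre : ((k : ℂ) ^ 2).re = (k : ℝ) ^ 2 := by
    rw [← Complex.ofReal_natCast, ← Complex.ofReal_pow, Complex.ofReal_re]
  -- Moving k² left by δ moves its root by at most δ, because k ≥ 1.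
  have hsq : ((k : ℝ) - δ) ^ 2 ≤ (k : ℝ) ^ 2 - δ := by nlinarith
  have hpos : 0 < ((k : ℝ) - δ) ^ 2 := by
    have : 0 < (k : ℝ) - δ := by linarith
    positivity
  have hdiv : -δ ≤ lam.re / ν := by
    rw [le_div_iff₀ (by linarith)]
    nlinarith
  have hE : ((k : ℝ) - δ) ^ 2 ≤ ((k : ℂ) ^ 2 + lam / ν).re := by
    rw [Complex.add_re, hkre, Complex.div_ofReal_re]
    linarith
  have hs : ((k : ℝ) - δ) ^ 2 ≤ ((k : ℂ) ^ 2 + lam).re := by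
    rw [Complex.add_re, hkre]
    linarith
  exact ⟨hE, le_csqrt_re hs, charFun_eq_of_isEigenvalue D.tall.pos hk D.hasDerivAt_integral
    D.contDiff_combination.continuous (hpos.trans_le hE) (hpos.trans_le hs) hev⟩

/-- Otherwise |s| ≤ (1 - ε/2)k, whereas |s|² ≥ k² - δ with δ ≤ ε/4; these are incompatible for k ≥
1. -/
lemma re_lt_of_isEigenvalue (D : IsDesign N B Y ε δ h φ₀ φ)
    (hc : ∀ j, |c j| ≤ 12 * N * ε * Real.exp (coeffExponent N B j)) {ν : ℝ} (hν : 1 ≤ ν)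
    {k : ℕ} (hk : N < k) {lam : ℂ}
    (hev : IsEigenvalue ν h (fun y => ∫ z in (0:ℝ)..y, combination φ₀ φ c z) k lam) :
    lam.re < -δ := by
  by_contra! hlam
  obtain ⟨hE, hs, heq⟩ := D.charFun_eq hν (by omega) hlam hev
  have hkN : (N : ℝ) + 1 ≤ k := by exact_mod_cast hk
  have hk1 : (1 : ℝ) ≤ k := by linarith [D.N_pos]
  have h1 := D.norm_charFun_lt_one hc hkN hE hs
  rw [heq, norm_div, Complex.norm_natCast, div_le_iff₀ (by linarith)] at h1
  have h2 : (k : ℝ) ^ 2 - δ ≤ ‖csqrt ((k : ℂ) ^ 2 + lam)‖ ^ 2 := by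
    rw [← norm_pow, csqrt_sq]
    refine le_trans ?_ (Complex.re_le_norm _)
    rw [Complex.add_re, ← Complex.ofReal_natCast, ← Complex.ofReal_pow, Complex.ofReal_re]
    linarith
  have h3 := pow_le_pow_left₀ (norm_nonneg _) h1 2
  have hε := D.ε_pos
  have hε1 := D.ε_le
  have hδ := D.δ_le
  have h4 : (1 - ε / 2) ^ 2 ≤ 1 - ε / 2 := by nlinarith
  have h5 : (1 - ε / 2) ^ 2 * (k : ℝ) ^ 2 ≤ (1 - ε / 2) * (k : ℝ) ^ 2 := by gcongr
  have h6 : ε * 1 ≤ ε * (k : ℝ) ^ 2 := mul_le_mul_of_nonneg_left (one_le_pow₀ hk1) hε.le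
  rw [mul_pow] at h3
  linarith

/-- Subtracting the equation at λ = 0 gives |s - k|/k ≤ |s - k|/(2N) with k ≤ N, hence s = k. -/
lemma eq_zero_of_isEigenvalue (D : IsDesign N B Y ε δ h φ₀ φ)
    (hc : ∀ j, |c j| ≤ 12 * N * ε * Real.exp (coeffExponent N B j)) {ν : ℝ}
    (hν : 1152 * (N : ℝ) ^ 3 ≤ ν) {k : ℕ} (hk : k ∈ Finset.Icc 1 N)
    (h1 : charFun h k (combination φ₀ φ c) ((k : ℂ) ^ 2) k = 1) {lam : ℂ} (hlam : -δ ≤ lam.re)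
    (hev : IsEigenvalue ν h (fun y => ∫ z in (0:ℝ)..y, combination φ₀ φ c z) k lam) :
    lam = 0 := by
  obtain ⟨hk1', hkN'⟩ := Finset.mem_Icc.1 hk
  have hk1 : (1 : ℝ) ≤ k := by exact_mod_cast hk1'
  have hkN : (k : ℝ) ≤ N := by exact_mod_cast hkN'
  have hN := D.N_pos
  have hN3 : (N : ℝ) ^ 2 ≤ (N : ℝ) ^ 3 := pow_le_pow_right₀ hN (by norm_num)
  have hν1 : 1 ≤ ν := by nlinarith
  have hν0 : 0 < ν := by linarith
  obtain ⟨hE, hs, heq⟩ := D.charFun_eq hν1 hk1' hlam hev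
  have hkC : (k : ℂ) ≠ 0 := by exact_mod_cast (show k ≠ 0 by omega)
  have hsq := csqrt_sq ((k : ℂ) ^ 2 + lam)
  set s := csqrt ((k : ℂ) ^ 2 + lam)
  have hsn : ‖s‖ ≤ 2 * k := by
    have := D.norm_charFun_le_two hc hk1 hE hs
    rwa [heq, norm_div, Complex.norm_natCast, div_le_iff₀ (by linarith)] at this
  have hfac : lam = (s - k) * (s + k) := by linear_combination -hsq
  have hlamn : ‖lam‖ ≤ ‖s - k‖ * (3 * k) := by
    rw [hfac, norm_mul]
    refine mul_le_mul_of_nonneg_left ((norm_add_le _ _).trans ?_) (norm_nonneg _)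
    rw [Complex.norm_natCast]
    linarith
  have hEn : ‖(k : ℂ) ^ 2 + lam / ν - (k : ℂ) ^ 2‖ = ‖lam‖ / ν := by
    rw [add_sub_cancel_left, norm_div, Complex.norm_of_nonneg hν0.le]
  have hsk : ‖s - k‖ ≤ 3 * k := by
    refine (norm_sub_le _ _).trans ?_
    rw [Complex.norm_natCast]
    linarith
  have key := D.norm_charFun_sub_le hc (E := (k : ℂ) ^ 2 + lam / ν) (s := s) hk1 hkN hν
    (by linarith [D.δ_le, D.ε_le]) ?_ ?_
  · rw [Complex.ofReal_natCast, heq, h1] at key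
    have e : s / k - 1 = (s - k) / k := by field_simp
    rw [e, norm_div, Complex.norm_natCast, div_le_div_iff₀ (by linarith) (by linarith)] at key
    have : ‖s - k‖ = 0 := by nlinarith [norm_nonneg (s - k)]
    rw [hfac, norm_eq_zero.1 this, zero_mul]
  -- The a priori bound gives |λ| ≤ 9k², and ν ≥ 1152 N³ exceeds twice that.
  · rw [Complex.ofReal_natCast, hEn, div_lt_iff₀ hν0]
    have : ‖s - k‖ * (3 * k) ≤ 3 * k * (3 * k) := by gcongr
    nlinarith
  · rw [Complex.ofReal_natCast, hEn, div_mul_cancel₀ _ hν0.ne']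
    linarith

end IsDesign

/-! ### Choice of the parameters -/

/-- The order matters: B depends on N, then Y on B, ε on the coefficient bound, δ on ε and Y. Only
then is h taken large, so δ does not see ν. -/
lemma exists_design_parameters (N : ℕ) (hN : 1 ≤ N) :
    ∃ B Y ε δ : ℝ, ∃ (φ₀ : ℝ → ℝ) (φ : Fin N → ℝ → ℝ), 0 < δ ∧
      ∀ᶠ h in Filter.atTop, IsDesign N B Y ε δ h φ₀ φ := by
  have hN1 : (1 : ℝ) ≤ N := by exact_mod_cast hN
  set B : ℝ := 48 * (N : ℝ) ^ 2 with hB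
  have hB1 : 1 ≤ B := by nlinarith
  set Y : ℝ := B * N + 1 with hY
  have hY1 : 1 ≤ Y := by nlinarith
  have hC := coeffBound_nonneg N B
  have hd : 1 ≤ 72 * N * (1 + Y * coeffBound N B) := by
    have : 0 ≤ Y * coeffBound N B := by positivity
    nlinarith
  set ε : ℝ := 1 / (72 * N * (1 + Y * coeffBound N B)) with hε
  have hε0 : 0 < ε := by positivity
  have hε1 : ε ≤ 1 := (div_le_one (by linarith)).2 hd
  have hev := (eventually_charKer_const (Y := Y) (θ := ε / 4) (by positivity)).and
    (Ioo_mem_nhdsGT (show (0 : ℝ) < ε / 4 by positivity))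
  obtain ⟨δ, hδ, hδ0, hδ1⟩ := hev.exists
  obtain ⟨φ₀, hφ₀⟩ := exists_isUnitBump (a := ε / 2) (b := ε) (by positivity) (by linarith)
  have hφ : ∀ j : Fin N, ∃ φ,
      IsUnitBump (B * ((j : ℝ) + 1)) (B * ((j : ℝ) + 1) + 1 / (8 * N)) φ := fun j =>
    exists_isUnitBump (by positivity) (by linarith [show 0 < 1 / (8 * (N : ℝ)) by positivity])
  choose φ hφ using hφ
  refine ⟨B, Y, ε, δ, φ₀, φ, hδ0, ?_⟩
  filter_upwards [eventually_isTall (a := ε / 2) (Y := Y) (η := δ) (by positivity) (by linarith)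
    hδ0 (by linarith)] with h hh
  refine ⟨hN, hB1, ?_, hY, hε0, ?_, hδ1.le, hδ, hh, hφ₀, hφ⟩
  · rw [← hB, Real.exp_neg, ← div_eq_mul_inv, div_le_one (Real.exp_pos _)]
    linarith [Real.add_one_le_exp B]
  · rw [hε, mul_one_div, div_self (by linarith)]

end Marangoni

theorem proposition6p2 (N : ℕ) (hN : 1 ≤ N) :
    ∃ U : ℝ → ℝ → ℝ, ∃ δ : ℝ, 0 < δ ∧ ∃ ν₀ : ℝ, 0 < ν₀ ∧ ∀ ν : ℝ, ν₀ < ν →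
      Marangoni.IsProfile (10 * Real.log ν) (U ν) ∧
      (∀ k : ℕ, k ∈ Finset.Icc 1 N →
        Marangoni.IsEigenvalue ν (10 * Real.log ν) (U ν) k 0 ∧
        ∀ lam : ℂ, Marangoni.IsEigenvalue ν (10 * Real.log ν) (U ν) k lam →
          lam = 0 ∨ lam.re < -δ) ∧
      (∀ k : ℕ, 1 ≤ k → k ∉ Finset.Icc 1 N →
        ∀ lam : ℂ, Marangoni.IsEigenvalue ν (10 * Real.log ν) (U ν) k lam → lam.re < -δ) := by
  obtain ⟨B, Y, ε, δ, φ₀, φ, hδ, hev⟩ := Marangoni.exists_design_parameters N hN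
  have hlog : Filter.Tendsto (fun ν : ℝ => 10 * Real.log ν) Filter.atTop Filter.atTop :=
    Real.tendsto_log_atTop.const_mul_atTop (by norm_num)
  obtain ⟨ν₁, hν₁⟩ := Filter.eventually_atTop.1 (hlog.eventually hev)
  -- The coefficients depend on ν through h. Below the threshold they are set to 0, only to make the
  -- profile a function of every ν.
  have hc : ∀ ν : ℝ, ∃ c : Fin N → ℝ, ν₁ ≤ ν →
      (∀ j, |c j| ≤ 12 * N * ε * Real.exp (Marangoni.coeffExponent N B j)) ∧
      ∀ k : ℕ, k ∈ Finset.Icc 1 N → Marangoni.charFun (10 * Real.log ν) k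
        (Marangoni.combination φ₀ φ c) ((k : ℂ) ^ 2) k = 1 := by
    intro ν
    by_cases hν : ν₁ ≤ ν
    · obtain ⟨c, hc⟩ := (hν₁ ν hν).exists_charFun_eq_one
      exact ⟨c, fun _ => hc⟩
    · exact ⟨0, fun h => absurd h hν⟩
  choose c hc using hc
  refine ⟨fun ν y => ∫ z in (0:ℝ)..y, Marangoni.combination φ₀ φ (c ν) z, δ, hδ,
    max ν₁ (1152 * (N : ℝ) ^ 3), lt_max_of_lt_right (by positivity), fun ν hν => ?_⟩
  have h1 : ν₁ ≤ ν := (le_max_left _ _).trans hν.le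
  have h2 : 1152 * (N : ℝ) ^ 3 ≤ ν := (le_max_right _ _).trans hν.le
  have D := hν₁ ν h1
  obtain ⟨hcb, hc1⟩ := hc ν h1
  have hν1 : 1 ≤ ν := by linarith [one_le_pow₀ D.N_pos (n := 3)]
  refine ⟨Marangoni.isProfile_integral D.tall.a_pos (D.tall.a_le.trans_lt D.tall.lt)
    D.contDiff_combination fun y hy => D.combination_eq_zero hy, fun k hk => ⟨?_, fun lam hl => ?_⟩,
    fun k hk1 hk lam hl => ?_⟩
  · exact Marangoni.isEigenvalue_zero_of_charFun D.tall.pos (Finset.mem_Icc.1 hk).1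
      D.hasDerivAt_integral D.contDiff_combination.continuous (hc1 k hk)
  · by_cases hlam : lam.re < -δ
    · exact Or.inr hlam
    · exact Or.inl (D.eq_zero_of_isEigenvalue hcb h2 hk (hc1 k hk) (not_lt.1 hlam) hl)
  · refine D.re_lt_of_isEigenvalue hcb hν1 ?_ hl
    by_contra hle
    exact hk (Finset.mem_Icc.2 ⟨hk1, not_lt.1 hle⟩)
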